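/- For each sample size $n=1,2,\dots$ let $(X_i,Z_i,W_i,Y_i)$, $i=1,\dots,n$, be i.i.d. draws from a distribution $\mathbb P_n$ (features $X_i\in\mathcal X$, instrument $Z_i$, treatment $W_i$, outcome $Y_i\in\mathbb R$), let $m_n(x,w)$, $g_n(x,z)$ and $\tau_n(x)=\tau_{m_n}(x)$ be the response surface, the weighting function and the conditional average treatment effect function (all measurable), and let $$\Gamma_i=\tau_n(X_i)+g_n(X_i,Z_i)\,\bigl(Y_i-m_n(X_i,W_i)\bigr)$$ be the oracle scores, with $\mathbb E_n[\Gamma_i\mid X_i]=\tau_n(X_i)$. Let $\Pi_n$ be a nonempty class of measurable policies $\pi:\mathcal X\to\{0,1\}$ that has a countable subclass such that every $\pi\in\Pi_n$ is a pointwise limit of a sequence from the subclass. Put $$V_n(\pi)=\mathbb E_n[\pi(X)\tau_n(X)],\quad A_n(\pi)=2V_n(\pi)-\mathbb E_n[\tau_n(X)],\quad R_n(\pi)=\sup_{\pi'\in\Pi_n}V_n(\pi')-V_n(\pi),$$ $$\Pi_n^\lambda=\{\pi\in\Pi_n:R_n(\pi)\le\lambda\},\quad \widetilde A_n(\pi)=\frac1n\sum_{i=1}^n(2\pi(X_i)-1)\Gamma_i,\quad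 S_n=\mathbb E_n[\Gamma_i^2],\quad S_n^\lambda=n\sup_{\pi\in\Pi_n^\lambda}\operatorname{Var}_n[\widetilde A_n(\pi)],$$ and, for a class $\Pi$ and independent random signs $\xi_i=\pm1$ with probability $1/2$ each, independent of the data, define the centered Rademacher complexity $$\mathcal R_n(\Pi)=\mathbb E\Bigl[\,\sup_{\pi\in\Pi}\frac1n\sum_{i=1}^n\xi_i\Bigl((2\pi(X_i)-1)\Gamma_i-\sup_{\pi'\in\Pi}A_n(\pi')\Bigr)\Bigm|\{X_i,\Gamma_i\}_{i=1}^n\Bigr].$$ There is a universal constant $C>0$ such that the following holds. Suppose that 1. there are a constant $0<\beta<1/2$ and a sequence $1\le d_n\le n^\beta$ such that the Vapnik-Chervonenkis dimension of $\Pi_n$ is at most $d_n$ for all $n\geq 1$; 2. there are constants $C_\nu,\nu,s>0$ such that $\mathbb P_n[|\Gamma_i|>t]\le C_\nu e^{-\nu t^2}$ for all $t>0$ and $\operatorname{Var}_n[\Gamma_i]\ge s^2$, for all $n\geq 1$. Then for every fixed $\lambda>0$, and also for $\lambda=0$ provided that $S_n^0$ is bounded below by a positive constant for all large $n$, $$\limsup_{n\to\infty}\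 \mathbb E_n\bigl[\mathcal R_n(\Pi_n^\lambda)\bigr]\Bigm/\sqrt{\bigl(S_n^\lambda+4\lambda^2\bigr)\Bigl(1+\Bigl\lfloor\log_4\Bigl(\frac{S_n}{S_n^\lambda}\Bigr)\Bigr\rfloor\Bigr)\frac{d_n}{n}}\ \le\ C,$$ where the logarithmic factor is read as $+\infty$ if $S_n^\lambda=0$, and the expectation $\mathbb E_n[\mathcal R_n(\Pi_n^\lambda)]$ is an outer expectation in case $\mathcal R_n(\Pi_n^\lambda)$ is not measurable. -/

import Mathlib

open MeasureTheory Filter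
open scoped ENNReal

/-- One observation `(X, Z, W, Y)`: features, instrument, treatment and outcome. -/
abbrev Obs (𝒳 𝒵 𝒲 : Type*) := 𝒳 × 𝒵 × 𝒲 × ℝ

/-- The data-generating distribution at one sample size, with the functions that enter the doubly
robust score: the response surface `m`, the weighting function `g` and the conditional average
treatment effect function `τ = τ_m`. -/
structure PolicyModel (𝒳 𝒵 𝒲 : Type*) [MeasurableSpace 𝒳] [MeasurableSpace 𝒵]
    [MeasurableSpace 𝒲] where
  /-- the joint law of `(X, Z, W, Y)` -/
  law : Measure (Obs 𝒳 𝒵 𝒲)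
  isProbabilityMeasure_law : IsProbabilityMeasure law
  m : 𝒳 → 𝒲 → ℝ
  g : 𝒳 → 𝒵 → ℝ
  τ : 𝒳 → ℝ
  measurable_m : Measurable (Function.uncurry m)
  measurable_g : Measurable (Function.uncurry g)
  measurable_τ : Measurable τ

attribute [instance] PolicyModel.isProbabilityMeasure_law

namespace PolicyModel

variable {𝒳 𝒵 𝒲 : Type*} [MeasurableSpace 𝒳] [MeasurableSpace 𝒵] [MeasurableSpace 𝒲]

/-- The oracle score `Γ = τ_m(X) + g(X, Z) (Y - m(X, W))`. -/
def score (M : PolicyModel 𝒳 𝒵 𝒲) (o : Obs 𝒳 𝒵 𝒲) : ℝ :=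
  M.τ o.1 + M.g o.1 o.2.1 * (o.2.2.2 - M.m o.1 o.2.2.1)

/-- The score identifies the treatment effect: `E[Γ | X] = τ(X)` almost surely. -/
def ScoreIdentifies (M : PolicyModel 𝒳 𝒵 𝒲) : Prop :=
  condExp (MeasurableSpace.comap (fun o : Obs 𝒳 𝒵 𝒲 => o.1) inferInstance) M.law M.score
    =ᵐ[M.law] fun o => M.τ o.1

/-- The law of the i.i.d. sample of size `n`. -/
noncomputable def sampleLaw (M : PolicyModel 𝒳 𝒵 𝒲) (n : ℕ) : Measure (Fin n → Obs 𝒳 𝒵 𝒲) :=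
  Measure.pi fun _ => M.law

end PolicyModel

/-- The decision `π(x) ∈ {0, 1}` as a real number. -/
def treat {𝒳 : Type*} (π : 𝒳 → Bool) (x : 𝒳) : ℝ := if π x then 1 else 0

/-- The sign `2 π(x) - 1 ∈ {-1, 1}` of the decision. -/
def signTreat {𝒳 : Type*} (π : 𝒳 → Bool) (x : 𝒳) : ℝ := 2 * treat π x - 1

/-- The class `P` shatters the finite set `s`: every labelling of `s` is realized in `P`. -/
def PolicyShatters {𝒳 : Type*} (P : Set (𝒳 → Bool)) (s : Finset 𝒳) : Prop :=
  ∀ b : 𝒳 → Bool, ∃ π ∈ P, ∀ x ∈ s, π x = b x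

/-- The Vapnik-Chervonenkis dimension of a class of policies. -/
noncomputable def policyVCDim {𝒳 : Type*} (P : Set (𝒳 → Bool)) : ℕ∞ :=
  ⨆ (s : Finset 𝒳) (_ : PolicyShatters P s), (s.card : ℕ∞)

/-- Pointwise measurability of a class of policies: its members are measurable, and each of them is
the pointwise limit of a sequence from one fixed countable subclass. -/
def PointwiseMeasurableClass {𝒳 : Type*} [MeasurableSpace 𝒳] (P : Set (𝒳 → Bool)) : Prop :=
  (∀ π ∈ P, Measurable π) ∧
    ∃ D ⊆ P, D.Countable ∧
      ∀ π ∈ P, ∃ u : ℕ → 𝒳 → Bool, (∀ k, u k ∈ D) ∧ ∀ x, ∀ᶠ k in atTop, u k x = π x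

/-- Outer expectation of a nonnegative function: the infimum of the integrals of its measurable
majorants. It is the expectation whenever the function is measurable. -/
noncomputable def outerExpectation {Ω : Type*} [MeasurableSpace Ω] (μ : Measure Ω)
    (f : Ω → ℝ≥0∞) : ℝ≥0∞ :=
  ⨅ (h : Ω → ℝ≥0∞) (_ : Measurable h) (_ : ∀ ω, f ω ≤ h ω), ∫⁻ ω, h ω ∂μ

theorem outerExpectation_eq_lintegral {Ω : Type*} [MeasurableSpace Ω] (μ : Measure Ω)
    {f : Ω → ℝ≥0∞} (hf : Measurable f) : outerExpectation μ f = ∫⁻ ω, f ω ∂μ :=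
  le_antisymm (iInf_le_of_le f (iInf_le_of_le hf (iInf_le _ fun _ => le_rfl)))
    (le_iInf fun _ => le_iInf fun _ => le_iInf fun hh => lintegral_mono hh)

namespace PolicyModel

variable {𝒳 𝒵 𝒲 : Type*} [MeasurableSpace 𝒳] [MeasurableSpace 𝒵] [MeasurableSpace 𝒲]

/-- The value `V(π) = E[π(X) τ(X)]`. -/
noncomputable def value (M : PolicyModel 𝒳 𝒵 𝒲) (π : 𝒳 → Bool) : ℝ :=
  ∫ o, treat π o.1 * M.τ o.1 ∂M.law

/-- The policy improvement `A(π) = 2 V(π) - E[τ(X)]`. -/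
noncomputable def advantage (M : PolicyModel 𝒳 𝒵 𝒲) (π : 𝒳 → Bool) : ℝ :=
  2 * M.value π - ∫ o, M.τ o.1 ∂M.law

/-- The regret `R(π) = sup {V(π') : π' ∈ P} - V(π)` relative to the class `P`. -/
noncomputable def regret (M : PolicyModel 𝒳 𝒵 𝒲) (P : Set (𝒳 → Bool)) (π : 𝒳 → Bool) : ℝ :=
  sSup (M.value '' P) - M.value π

/-- The slice `P^lam` of the policies in `P` with regret at most `lam`. -/
def slice (M : PolicyModel 𝒳 𝒵 𝒲) (P : Set (𝒳 → Bool)) (lam : ℝ) : Set (𝒳 → Bool) :=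
  {π ∈ P | M.regret P π ≤ lam}

/-- The oracle estimate `Ã(π) = n⁻¹ ∑ (2 π(X_i) - 1) Γ_i` of the policy improvement. -/
noncomputable def oracleEstimate (M : PolicyModel 𝒳 𝒵 𝒲) (n : ℕ) (π : 𝒳 → Bool)
    (ω : Fin n → Obs 𝒳 𝒵 𝒲) : ℝ :=
  (n : ℝ)⁻¹ * ∑ i, signTreat π (ω i).1 * M.score (ω i)

/-- `S = E[Γ²]`. -/
noncomputable def scoreSecondMoment (M : PolicyModel 𝒳 𝒵 𝒲) : ℝ :=
  ∫ o, M.score o ^ 2 ∂M.law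

/-- `S^lam = n sup {Var[Ã(π)] : π ∈ P^lam}`. -/
noncomputable def sliceVariance (M : PolicyModel 𝒳 𝒵 𝒲) (n : ℕ) (P : Set (𝒳 → Bool))
    (lam : ℝ) : ℝ :=
  n * sSup ((fun π => ProbabilityTheory.variance (M.oracleEstimate n π) (M.sampleLaw n)) ''
    M.slice P lam)

/-- The centered Rademacher complexity of the class `P` given the sample `ω`: the average, over all
sign vectors `ξ ∈ {-1, 1}ⁿ`, of
`sup_{π ∈ P} n⁻¹ ∑ ξ_i (Γ_i (2 π(X_i) - 1) - sup {A(π') : π' ∈ P})`. -/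
noncomputable def centeredRademacher (M : PolicyModel 𝒳 𝒵 𝒲) (n : ℕ) (P : Set (𝒳 → Bool))
    (ω : Fin n → Obs 𝒳 𝒵 𝒲) : ℝ :=
  (2 ^ n : ℝ)⁻¹ * ∑ ξ : Fin n → ℤˣ,
    sSup ((fun π => (n : ℝ)⁻¹ * ∑ i, ((ξ i : ℤ) : ℝ) *
      (M.score (ω i) * signTreat π (ω i).1 - sSup (M.advantage '' P))) '' P)

end PolicyModel

/-- `1 + ⌊log_4 (S / S')⌋`, which is infinite for `S' = 0`. -/
noncomputable def logFactor (S S' : ℝ) : ℝ≥0∞ :=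
  if S' = 0 then ∞ else ENNReal.ofReal (1 + (⌊Real.logb 4 (S / S')⌋ : ℝ))

/-- `√((S^lam + 4 lam²) (1 + ⌊log_4 (S / S^lam)⌋) d / n)` for the slice `P^lam`. -/
noncomputable def PolicyModel.sliceRate {𝒳 𝒵 𝒲 : Type*} [MeasurableSpace 𝒳] [MeasurableSpace 𝒵]
    [MeasurableSpace 𝒲] (M : PolicyModel 𝒳 𝒵 𝒲) (n : ℕ) (P : Set (𝒳 → Bool)) (d lam : ℝ) :
    ℝ≥0∞ :=
  (ENNReal.ofReal (M.sliceVariance n P lam + 4 * lam ^ 2)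
    * logFactor M.scoreSecondMoment (M.sliceVariance n P lam)
    * ENNReal.ofReal (d / n)) ^ (1 / 2 : ℝ)

/-! The slice is a small ball. Write f_π = (2π(X)-1)Γ and let a be the optimal improvement 2 sup V -
E τ over the whole class. Since E f_π = A(π), splitting into variance and squared bias gives E(f_π -
a)² ≤ σ² := S^λ + 4λ² for π in the slice. Where π and π' disagree, f_π = -f_π', so Γ² is at most the
average of (f_π - a)² and (f_π' - a)². Hence E[Γ² 1{π ≠ π'}] ≤ σ² (`integral_disagreement_le`): in
the metric natural for Rademacher sums the slice has diameter at most σ.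

Given the sample, the centering constant in the complexity drops out because signed sums of
constants have mean zero. Dudley chaining (`signMean_chaining_le`), with a packing bound for
weighted symmetric differences (`log_card_le_of_separated`), gives 40 (r/n) √(D (1 + log(1 +
W/r²))), where W = ∑ Γ_i² and r is a radius of the class in the empirical metric. A packing bound
without a logarithm of n is what allows the rate to involve only S/σ².

The empirical radius is compared with the population radius by symmetrization, using fourth moments
and the Sauer-Shelah count (`lintegral_iSup_disagreement_le`). The error is of order √(n (D log n +
1)), which is o(n) because D ≤ n^β, hence below nσ² for large n as soon as σ² is bounded away from
zero. Linearizing the square root and the logarithm makes the conditional bound affine in the random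
radius and in W, so their expectations suffice (`outerExpectation_centeredRademacher_le`). Finally 1
+ log(1 + S/σ²) is at most a multiple of the floored logarithmic factor.

Suprema over the slice need not be measurable. A countable family in a slightly larger ball that
reproduces every sample pattern of the slice (`exists_dense_sequence`) supplies a measurable
majorant, as the outer expectation requires. -/

/-- The average of `f` over all sign vectors. -/
noncomputable def signMean {ι : Type*} [Fintype ι] [DecidableEq ι] (f : (ι → ℤˣ) → ℝ) : ℝ :=
  (2 ^ Fintype.card ι : ℝ)⁻¹ * ∑ ξ : ι → ℤˣ, f ξ

/-! ### Rademacher averages and the finite maximal inequality. -/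

section SignMean

variable {ι : Type*} [Fintype ι] [DecidableEq ι]

theorem signMean_add (f g : (ι → ℤˣ) → ℝ) :
    signMean (fun ξ => f ξ + g ξ) = signMean f + signMean g := by
  simp only [signMean, Finset.sum_add_distrib, mul_add]

theorem signMean_const_mul (c : ℝ) (f : (ι → ℤˣ) → ℝ) :
    signMean (fun ξ => c * f ξ) = c * signMean f := by
  simp only [signMean, ← Finset.mul_sum]; ring

theorem signMean_mono {f g : (ι → ℤˣ) → ℝ} (h : ∀ ξ, f ξ ≤ g ξ) : signMean f ≤ signMean g := by
  unfold signMean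
  gcongr with ξ
  exact h ξ

theorem signMean_const (c : ℝ) : signMean (fun _ : ι → ℤˣ => c) = c := by
  have h : Fintype.card (ι → ℤˣ) = 2 ^ Fintype.card ι := by
    rw [Fintype.card_fun, Fintype.card_units_int]
  simp [signMean, Finset.card_univ, h]

theorem signMean_prod (g : ι → ℤˣ → ℝ) :
    signMean (fun ξ => ∏ i, g i (ξ i)) = ∏ i, ((g i 1 + g i (-1)) / 2) := by
  have h : ∏ i, (g i 1 + g i (-1)) = ∑ ξ : ι → ℤˣ, ∏ i, g i (ξ i) := by
    have := Finset.prod_univ_sum (fun _ : ι => (Finset.univ : Finset ℤˣ)) g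
    rw [Fintype.piFinset_univ] at this
    rw [← this]
    refine Finset.prod_congr rfl fun i _ => ?_
    rw [show (Finset.univ : Finset ℤˣ) = {1, -1} from rfl, Finset.sum_pair (by decide)]
  simp only [signMean, Finset.prod_div_distrib, h, Finset.prod_const, Finset.card_univ]
  ring

theorem signMean_neg (f : (ι → ℤˣ) → ℝ) : signMean (fun ξ => f (-ξ)) = signMean f := by
  unfold signMean
  congr 1
  exact Fintype.sum_equiv (Equiv.neg _) _ _ fun ξ => rfl

theorem signMean_sum_const (v : ι → ℝ) :
    signMean (fun ξ => ∑ i, ((ξ i : ℤ) : ℝ) * v i) = 0 := by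
  have h := signMean_neg (fun ξ : ι → ℤˣ => ∑ i, ((ξ i : ℤ) : ℝ) * v i)
  have h2 : (fun ξ : ι → ℤˣ => ∑ i, (((-ξ) i : ℤ) : ℝ) * v i)
      = fun ξ => (-1) * ∑ i, ((ξ i : ℤ) : ℝ) * v i := by
    funext ξ; simp [Finset.sum_neg_distrib]
  rw [h2, signMean_const_mul] at h
  linarith

theorem signMean_exp_le (v : ι → ℝ) (t : ℝ) :
    signMean (fun ξ => Real.exp (t * ∑ i, ((ξ i : ℤ) : ℝ) * v i))
      ≤ Real.exp (t ^ 2 * (∑ i, v i ^ 2) / 2) := by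
  have h : (fun ξ : ι → ℤˣ => Real.exp (t * ∑ i, ((ξ i : ℤ) : ℝ) * v i))
      = fun ξ => ∏ i, (fun (i : ι) (e : ℤˣ) => Real.exp (t * (((e : ℤ) : ℝ) * v i))) i (ξ i) := by
    funext ξ
    rw [Finset.mul_sum, Real.exp_sum]
  rw [h, signMean_prod fun (i : ι) (e : ℤˣ) => Real.exp (t * (((e : ℤ) : ℝ) * v i)),
    Finset.mul_sum, Finset.sum_div, Real.exp_sum]
  refine Finset.prod_le_prod (fun i _ => by positivity) fun i _ => ?_
  have := Real.cosh_le_exp_half_sq (t * v i)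
  rw [Real.cosh_eq] at this
  simpa [mul_pow] using this

/-- Maximal inequality for Rademacher sums, for an arbitrary choice of the index. -/
theorem signMean_selection_le {B : Type*} (F : Finset B) (v : B → ι → ℝ) (a : (ι → ℤˣ) → B)
    (ha : ∀ ξ, a ξ ∈ F) {ℓ t S : ℝ} (ht : 0 < t) (hF : (F.card : ℝ) ≤ Real.exp ℓ)
    (hv : ∀ b ∈ F, ∑ i, v b i ^ 2 ≤ S) :
    signMean (fun ξ => ∑ i, ((ξ i : ℤ) : ℝ) * v (a ξ) i) ≤ ℓ / t + t * S / 2 := by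
  -- The tangent line of `exp` at `t * y` plays the part of Jensen's inequality: x ≤ y - 1/t + exp(t
  -- x - t y)/t. With this `y` the sum of exponentials over `F` has mean at most exp(t y), so the
  -- last term averages to at most 1/t.
  set y : ℝ := ℓ / t + t * S / 2 with hy
  have hty : t * y = ℓ + t ^ 2 * S / 2 := by rw [hy]; field_simp
  have key : ∀ ξ : ι → ℤˣ, ∑ i, ((ξ i : ℤ) : ℝ) * v (a ξ) i ≤
      (y - 1 / t) + (Real.exp (-(t * y)) / t) *
        ∑ b ∈ F, Real.exp (t * ∑ i, ((ξ i : ℤ) : ℝ) * v b i) := by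
    intro ξ
    set x := ∑ i, ((ξ i : ℤ) : ℝ) * v (a ξ) i with hx
    have h1 : Real.exp (t * x) ≤ ∑ b ∈ F, Real.exp (t * ∑ i, ((ξ i : ℤ) : ℝ) * v b i) :=
      Finset.single_le_sum (f := fun b => Real.exp (t * ∑ i, ((ξ i : ℤ) : ℝ) * v b i))
        (fun b _ => (Real.exp_pos _).le) (ha ξ)
    have h2 := Real.add_one_le_exp (t * x - t * y)
    have h3 : x ≤ (y - 1 / t) + Real.exp (t * x - t * y) / t := by
      have : x = (y - 1 / t) + (t * x - t * y + 1) / t := by field_simp; ring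
      rw [this]; gcongr; rw [← this]; exact h2
    refine h3.trans ?_
    have : Real.exp (t * x - t * y) / t = Real.exp (-(t * y)) / t * Real.exp (t * x) := by
      rw [sub_eq_add_neg, Real.exp_add]; ring
    rw [this]
    gcongr
  refine (signMean_mono key).trans ?_
  rw [signMean_add, signMean_const, signMean_const_mul]
  have h4 : signMean (fun ξ : ι → ℤˣ => ∑ b ∈ F, Real.exp (t * ∑ i, ((ξ i : ℤ) : ℝ) * v b i))
      ≤ Real.exp (t * y) := by
    have : signMean (fun ξ : ι → ℤˣ => ∑ b ∈ F, Real.exp (t * ∑ i, ((ξ i : ℤ) : ℝ) * v b i))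
        = ∑ b ∈ F, signMean (fun ξ : ι → ℤˣ => Real.exp (t * ∑ i, ((ξ i : ℤ) : ℝ) * v b i)) := by
      simp only [signMean]; rw [Finset.sum_comm, Finset.mul_sum]
    rw [this, hty, Real.exp_add]
    calc _ ≤ ∑ b ∈ F, Real.exp (t ^ 2 * S / 2) := by
          refine Finset.sum_le_sum fun b hb => (signMean_exp_le _ _).trans ?_
          gcongr
          exact hv b hb
      _ = F.card * Real.exp (t ^ 2 * S / 2) := by simp
      _ ≤ _ := by gcongr
  have h5 : Real.exp (-(t * y)) / t * signMean
      (fun ξ : ι → ℤˣ => ∑ b ∈ F, Real.exp (t * ∑ i, ((ξ i : ℤ) : ℝ) * v b i)) ≤ 1 / t := by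
    calc _ ≤ Real.exp (-(t * y)) / t * Real.exp (t * y) := by gcongr
      _ = 1 / t := by rw [div_mul_eq_mul_div, ← Real.exp_add]; simp
  linarith

end SignMean

/-! ### Sauer-Shelah and packing numbers for weighted symmetric differences. -/

section Packing

variable {ι : Type*} [DecidableEq ι]

/-- Sauer-Shelah, in exponential form, for a family that is determined by its trace on `S`. -/
theorem card_le_exp_of_vcDim_le (F : Finset (Finset ι)) (S : Finset ι) {D : ℕ}
    (hD : F.vcDim ≤ D) (hS : ∀ A ∈ F, ∀ B ∈ F, A ∩ S = B ∩ S → A = B) {x : ℝ} (hx : 0 < x)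
    (hx1 : x ≤ 1) :
    (F.card : ℝ) ≤ (x⁻¹) ^ D * Real.exp (x * S.card) := by
  set G := F.image (· ∩ S) with hG
  have hc : F.card = G.card := (Finset.card_image_of_injOn fun A hA B hB h => hS A hA B hB h).symm
  have hsub : ∀ s ∈ G.shatterer, s ∈ S.powerset ∧ s.card ≤ D := by
    intro s hs
    rw [Finset.mem_shatterer] at hs
    obtain ⟨u, hu, hsu⟩ := hs.exists_superset
    obtain ⟨A, hA, rfl⟩ := Finset.mem_image.1 hu
    have hsS : s ⊆ S := hsu.trans Finset.inter_subset_right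
    refine ⟨Finset.mem_powerset.2 hsS, ?_⟩
    have : F.Shatters s := by
      intro t ht
      obtain ⟨u, hu, rfl⟩ := hs ht
      obtain ⟨A, hA, rfl⟩ := Finset.mem_image.1 hu
      refine ⟨A, hA, ?_⟩
      ext i
      simp only [Finset.mem_inter]
      exact ⟨fun h => ⟨h.1, h.2, hsS h.1⟩, fun h => ⟨h.1, h.2.1⟩⟩
    exact this.card_le_vcDim.trans hD
  -- A family has at most as many members as it shatters sets. The shattered sets have at most `D`
  -- points, so the weight x^(|s| - D) of each is at least 1 when x ≤ 1; the binomial theorem sums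
  -- these weights over all subsets of `S`.
  calc (F.card : ℝ) ≤ G.shatterer.card := by rw [hc]; exact_mod_cast G.card_le_card_shatterer
    _ = ∑ s ∈ G.shatterer, (1 : ℝ) := by simp
    _ ≤ ∑ s ∈ G.shatterer, (x⁻¹) ^ D * x ^ s.card := by
        refine Finset.sum_le_sum fun s hs => ?_
        rw [inv_pow, ← div_eq_inv_mul, one_le_div (by positivity)]
        exact pow_le_pow_of_le_one hx.le hx1 (hsub s hs).2
    _ ≤ ∑ s ∈ S.powerset, (x⁻¹) ^ D * x ^ s.card :=
        Finset.sum_le_sum_of_subset_of_nonneg (fun s hs => (hsub s hs).1)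
          fun _ _ _ => by positivity
    _ = (x⁻¹) ^ D * (1 + x) ^ S.card := by
        rw [← Finset.mul_sum]
        congr 1
        have := Finset.sum_pow_mul_eq_add_pow x 1 S
        simpa [add_comm] using this
    _ ≤ _ := by
        gcongr
        rw [mul_comm, Real.exp_nat_mul]
        gcongr
        rw [add_comm]
        exact Real.add_one_le_exp x

/-- A sample that separates the members of a family whose pairwise symmetric differences carry
more than a fixed share of the total weight. -/
theorem exists_separating_sample [Fintype ι] (F : Finset (Finset ι)) (w : ι → ℝ)
    (hw : ∀ i, 0 ≤ w i) {δ : ℝ} (hδ : 0 < δ)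
    (hsep : ∀ A ∈ F, ∀ B ∈ F, A ≠ B → δ < ∑ i ∈ symmDiff A B, w i) {m : ℕ}
    (hm : 2 * Real.log F.card * (∑ i, w i) / δ < m) :
    ∃ S : Finset ι, S.card ≤ m ∧ ∀ A ∈ F, ∀ B ∈ F, A ∩ S = B ∩ S → A = B := by
  classical
  set W := ∑ i, w i with hW
  -- Probabilistic method by weighted counting: `m` points are drawn with law proportional to `w`,
  -- and a given pair is left unseparated with probability below (1 - δ/W)^m. A union bound over
  -- fewer than |F|² pairs is then less than 1. In `hcount` this is the comparison of the total
  -- weight W^m of all words of length `m` with the weight of the words that miss some pair.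
  by_contra hcon
  push Not at hcon
  have hj : ∀ j : Fin m → ι, ∃ p ∈ F.offDiag, ∀ l, j l ∉ symmDiff p.1 p.2 := by
    intro j
    obtain ⟨A, hA, B, hB, hAB, hne⟩ := hcon (Finset.univ.image j)
      (Finset.card_image_le.trans (by simp))
    refine ⟨(A, B), Finset.mem_offDiag.2 ⟨hA, hB, hne⟩, fun l hl => ?_⟩
    have h := Finset.ext_iff.1 hAB (j l)
    simp only [Finset.mem_inter, Finset.mem_image, Finset.mem_univ, true_and,
      exists_apply_eq_apply, and_true] at h
    rw [Finset.mem_symmDiff] at hl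
    tauto
  have hcount : W ^ m ≤ ∑ p ∈ F.offDiag, (W - ∑ i ∈ symmDiff p.1 p.2, w i) ^ m := by
    have e1 : W ^ m = ∑ j : Fin m → ι, ∏ l, w (j l) := by
      have := Finset.sum_pow' (Finset.univ : Finset ι) w m
      rw [hW, this, Fintype.piFinset_univ]
    have e2 : ∀ p : Finset ι × Finset ι, (W - ∑ i ∈ symmDiff p.1 p.2, w i) ^ m
        = ∑ j : Fin m → ι, if ∀ l, j l ∉ symmDiff p.1 p.2 then ∏ l, w (j l) else 0 := by
      intro p
      have h1 : W - ∑ i ∈ symmDiff p.1 p.2, w i = ∑ i ∈ (symmDiff p.1 p.2)ᶜ, w i := by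
        rw [hW, ← Finset.sum_add_sum_compl (symmDiff p.1 p.2)]; ring
      rw [h1, Finset.sum_pow', ← Finset.sum_filter]
      refine Finset.sum_congr ?_ fun _ _ => rfl
      ext j
      simp only [Fintype.mem_piFinset, Finset.mem_compl, Finset.mem_filter, Finset.mem_univ,
        true_and]
    rw [e1, Finset.sum_congr rfl fun p _ => e2 p, Finset.sum_comm]
    refine Finset.sum_le_sum fun j _ => ?_
    obtain ⟨p, hp, hpj⟩ := hj j
    refine le_trans ?_ (Finset.single_le_sum
      (f := fun p : Finset ι × Finset ι => if ∀ l, j l ∉ symmDiff p.1 p.2 then ∏ l, w (j l) else 0)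
      (fun q _ => ?_) hp)
    · simp [hpj]
    · split_ifs
      · exact Finset.prod_nonneg fun l _ => hw _
      · exact le_rfl
  obtain ⟨p, hp, -⟩ : ∃ p, p ∈ F.offDiag ∧ True := by
    obtain ⟨A, hA, B, hB, -, hne⟩ := hcon ∅ (by simp)
    exact ⟨(A, B), Finset.mem_offDiag.2 ⟨hA, hB, hne⟩, trivial⟩
  have hle : ∀ p : Finset ι × Finset ι, ∑ i ∈ symmDiff p.1 p.2, w i ≤ W := fun p =>
    Finset.sum_le_sum_of_subset_of_nonneg (Finset.subset_univ _) fun i _ _ => hw i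
  have hsp : ∀ p ∈ F.offDiag, δ < ∑ i ∈ symmDiff p.1 p.2, w i := fun p hp => by
    rw [Finset.mem_offDiag] at hp
    exact hsep _ hp.1 _ hp.2.1 hp.2.2
  have hWδ : δ < W := (hsp p hp).trans_le (hle p)
  have hWpos : 0 < W := hδ.trans hWδ
  have hNpos : (0 : ℝ) < F.card := by
    have : p.1 ∈ F := (Finset.mem_offDiag.1 hp).1
    exact_mod_cast Finset.card_pos.2 ⟨_, this⟩
  have h1 : W ^ m ≤ (F.card : ℝ) ^ 2 * (W - δ) ^ m := by
    refine hcount.trans ?_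
    calc _ ≤ ∑ p ∈ F.offDiag, (W - δ) ^ m := by
          refine Finset.sum_le_sum fun p hp => ?_
          have := hle p
          have := hsp p hp
          gcongr
      _ = F.offDiag.card * (W - δ) ^ m := by simp
      _ ≤ _ := by
          have : (0 : ℝ) ≤ (W - δ) ^ m := pow_nonneg (by linarith) _
          gcongr
          rw [Finset.offDiag_card, sq]
          exact_mod_cast Nat.sub_le _ _
  have h2 : (W - δ) ^ m ≤ W ^ m * Real.exp (-(m * δ / W)) := by
    have : W - δ ≤ W * Real.exp (-(δ / W)) := by
      have := Real.add_one_le_exp (-(δ / W))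
      calc W - δ = W * (-(δ / W) + 1) := by field_simp; ring
        _ ≤ _ := by gcongr
    calc (W - δ) ^ m ≤ (W * Real.exp (-(δ / W))) ^ m := by
          gcongr
      _ = _ := by
          rw [mul_pow, ← Real.exp_nat_mul]; congr 2; ring
  have h3 : (F.card : ℝ) ^ 2 = Real.exp (2 * Real.log F.card) := by
    rw [two_mul, Real.exp_add, Real.exp_log hNpos, sq]
  have h4 : W ^ m ≤ W ^ m * Real.exp (2 * Real.log F.card - m * δ / W) := by
    calc W ^ m ≤ (F.card : ℝ) ^ 2 * (W ^ m * Real.exp (-(m * δ / W))) := by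
          refine h1.trans ?_; gcongr
      _ = _ := by rw [h3, sub_eq_add_neg, Real.exp_add]; ring
  have h5 : 2 * Real.log F.card - m * δ / W < 0 := by
    rw [div_lt_iff₀ hδ] at hm
    rw [sub_neg, lt_div_iff₀ hWpos]
    exact hm
  have h6 := Real.exp_lt_one_iff.2 h5
  have h7 : 0 < W ^ m := by positivity
  nlinarith

/-- Packing bound for families of finite Vapnik-Chervonenkis dimension. -/
theorem log_card_le_of_separated [Fintype ι] (F : Finset (Finset ι)) (w : ι → ℝ)
    (hw : ∀ i, 0 ≤ w i) {δ : ℝ} (hδ : 0 < δ) {D : ℕ} (hD : F.vcDim ≤ D)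
    (hsep : ∀ A ∈ F, ∀ B ∈ F, A ≠ B → δ < ∑ i ∈ symmDiff A B, w i) :
    (F.card : ℝ) ≤ Real.exp (2 * D * Real.log (4 + 4 * (∑ i, w i) / δ) + 1 / 2) := by
  set W := ∑ i, w i with hW
  have hW0 : 0 ≤ W := Finset.sum_nonneg fun i _ => hw i
  have hlog4 : 0 ≤ Real.log (4 + 4 * W / δ) := Real.log_nonneg (by
    have : 0 ≤ 4 * W / δ := by positivity
    linarith)
  rcases Nat.lt_or_ge 1 F.card with hc | hc
  · obtain ⟨A, hA, B, hB, hne⟩ := Finset.one_lt_card.1 hc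
    have hWδ : δ < W := (hsep A hA B hB hne).trans_le
      (Finset.sum_le_sum_of_subset_of_nonneg (Finset.subset_univ _) fun i _ _ => hw i)
    have hWpos : 0 < W := hδ.trans hWδ
    have hNpos : (0 : ℝ) < F.card := by exact_mod_cast (zero_lt_one.trans hc)
    set q := 2 * Real.log F.card * W / δ with hq
    have hq0 : 0 ≤ q := by
      have : 0 ≤ Real.log F.card := Real.log_nonneg (by exact_mod_cast hc.le)
      positivity
    obtain ⟨S, hSm, hS⟩ := exists_separating_sample F w hw hδ hsep (m := ⌊q⌋₊ + 1)
      (by push_cast; exact Nat.lt_floor_add_one q)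
    have hSq : (S.card : ℝ) ≤ q + 1 := by
      calc (S.card : ℝ) ≤ ((⌊q⌋₊ + 1 : ℕ) : ℝ) := by exact_mod_cast hSm
        _ ≤ q + 1 := by push_cast; linarith [Nat.floor_le hq0]
    -- This is the parameter x of the Sauer-Shelah bound. Since the separating sample has about 2
    -- log|F| · W/δ points, the term x |S| costs half of log|F| and can be absorbed on the left;
    -- what remains is D log(4W/δ).
    have hx : 0 < δ / (4 * W) := by positivity
    have hx1 : δ / (4 * W) ≤ 1 / 4 := by
      rw [div_le_div_iff₀ (by positivity) (by norm_num)]; linarith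
    have h := card_le_exp_of_vcDim_le F S hD hS hx (hx1.trans (by norm_num))
    have h1 : Real.log F.card ≤ D * Real.log (4 * W / δ) + δ / (4 * W) * S.card := by
      have := Real.log_le_log hNpos h
      rwa [Real.log_mul (by positivity) (by positivity), Real.log_pow, Real.log_exp, inv_div]
        at this
    have h2 : δ / (4 * W) * S.card ≤ Real.log F.card / 2 + 1 / 4 := by
      calc δ / (4 * W) * S.card ≤ δ / (4 * W) * (q + 1) := by gcongr
        _ = Real.log F.card / 2 + δ / (4 * W) := by rw [hq]; field_simp; ring
        _ ≤ _ := by linarith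
    have h3 : Real.log (4 * W / δ) ≤ Real.log (4 + 4 * W / δ) :=
      Real.log_le_log (by positivity) (by linarith)
    have h4 : (D : ℝ) * Real.log (4 * W / δ) ≤ D * Real.log (4 + 4 * W / δ) := by gcongr
    rw [← Real.log_le_iff_le_exp hNpos]
    linarith
  · calc (F.card : ℝ) ≤ 1 := by exact_mod_cast hc
      _ ≤ _ := Real.one_le_exp (by positivity)

end Packing

/-! ### Dudley chaining over families of subsets of the sample. -/

section Chaining

variable {ι : Type*} [Fintype ι] [DecidableEq ι]

/-- The sign `1` on `A` and `-1` off `A`. -/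
def setSign (A : Finset ι) (i : ι) : ℝ := if i ∈ A then 1 else -1

theorem sum_mul_setSign_sub_sq (γ : ι → ℝ) (A B : Finset ι) :
    ∑ i, (γ i * (setSign A i - setSign B i)) ^ 2 = 4 * ∑ i ∈ symmDiff A B, γ i ^ 2 := by
  rw [← Finset.sum_subset (Finset.subset_univ (symmDiff A B)), Finset.mul_sum]
  · refine Finset.sum_congr rfl fun i hi => ?_
    rw [Finset.mem_symmDiff] at hi
    rcases hi with ⟨h1, h2⟩ | ⟨h1, h2⟩ <;> simp only [setSign, h1, h2, if_true, if_false] <;> ring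
  · intro i _ hi
    rw [Finset.mem_symmDiff] at hi
    by_cases h1 : i ∈ A <;> by_cases h2 : i ∈ B <;> simp_all [setSign]

/-- A separated subfamily of maximal cardinality is a net, since a point far from all its members
could be added. -/
theorem exists_separated_net (T : Finset (Finset ι)) (w : ι → ℝ) {δ : ℝ} (hδ : 0 ≤ δ) :
    ∃ N ⊆ T, (∀ A ∈ N, ∀ B ∈ N, A ≠ B → δ < ∑ i ∈ symmDiff A B, w i) ∧
      ∀ A ∈ T, ∃ B ∈ N, ∑ i ∈ symmDiff A B, w i ≤ δ := by
  classical
  obtain ⟨N, hN, hmax⟩ := Finset.exists_max_image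
    (T.powerset.filter fun N => ∀ A ∈ N, ∀ B ∈ N, A ≠ B → δ < ∑ i ∈ symmDiff A B, w i)
    Finset.card ⟨∅, by simp⟩
  rw [Finset.mem_filter, Finset.mem_powerset] at hN
  refine ⟨N, hN.1, hN.2, fun A hA => ?_⟩
  by_contra! hcon
  have hAN : A ∉ N := fun h => by
    have := hcon A h
    rw [symmDiff_self] at this
    simp at this
    linarith
  have := hmax (insert A N) (by
    rw [Finset.mem_filter, Finset.mem_powerset]
    refine ⟨Finset.insert_subset hA hN.1, fun B hB C hC hne => ?_⟩
    rcases Finset.mem_insert.1 hB with rfl | hBN <;>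
      rcases Finset.mem_insert.1 hC with rfl | hCN
    · exact absurd rfl hne
    · exact hcon C hCN
    · rw [symmDiff_comm]; exact hcon B hBN
    · exact hN.2 B hBN C hCN hne)
  rw [Finset.card_insert_of_notMem hAN] at this
  omega

/-- One link of the chain: moving a choice from `F` to nearby points. -/
theorem signMean_chain_step (F : Finset (Finset ι)) (γ : ι → ℝ) {ρ ℓ : ℝ} (hρ : 0 < ρ)
    (hℓ : 0 < ℓ) (hF : (F.card : ℝ) ≤ Real.exp ℓ) (p : Finset ι → Finset ι)
    (hp : ∀ A ∈ F, ∑ i ∈ symmDiff A (p A), γ i ^ 2 ≤ ρ ^ 2) (a : (ι → ℤˣ) → Finset ι)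
    (ha : ∀ ξ, a ξ ∈ F) :
    signMean (fun ξ => ∑ i, ((ξ i : ℤ) : ℝ) * (γ i * setSign (a ξ) i)) ≤
      signMean (fun ξ => ∑ i, ((ξ i : ℤ) : ℝ) * (γ i * setSign (p (a ξ)) i))
        + 2 * ρ * √(2 * ℓ) := by
  have h := signMean_selection_le F (fun A i => γ i * (setSign A i - setSign (p A) i)) a ha
    (ℓ := ℓ) (t := √(2 * ℓ) / (2 * ρ)) (S := 4 * ρ ^ 2) (by positivity) hF
    (fun A hA => by
      rw [sum_mul_setSign_sub_sq]
      have := hp A hA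
      linarith)
  have hs : √(2 * ℓ) ^ 2 = 2 * ℓ := Real.sq_sqrt (by positivity)
  have hs0 : 0 < √(2 * ℓ) := by positivity
  have e : ℓ / (√(2 * ℓ) / (2 * ρ)) + √(2 * ℓ) / (2 * ρ) * (4 * ρ ^ 2) / 2 = 2 * ρ * √(2 * ℓ) := by
    generalize √(2 * ℓ) = q at hs hs0
    obtain rfl : ℓ = q ^ 2 / 2 := by linarith
    field_simp
    ring
  rw [e] at h
  have e2 : (fun ξ : ι → ℤˣ => ∑ i, ((ξ i : ℤ) : ℝ) * (γ i * setSign (a ξ) i))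
      = fun ξ => ∑ i, ((ξ i : ℤ) : ℝ) * (γ i * setSign (p (a ξ)) i)
        + ∑ i, ((ξ i : ℤ) : ℝ) * (γ i * (setSign (a ξ) i - setSign (p (a ξ)) i)) := by
    funext ξ
    rw [← Finset.sum_add_distrib]
    refine Finset.sum_congr rfl fun i _ => ?_
    ring
  rw [e2, signMean_add]
  linarith

/-- Dudley's chaining bound for the signed sums over a family of finite Vapnik-Chervonenkis
dimension that lies in a ball of radius `r`. -/
theorem signMean_chaining_le (T : Finset (Finset ι)) (γ : ι → ℝ) {D : ℕ} (hD : T.vcDim ≤ D)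
    (hD1 : 1 ≤ D) {A₀ : Finset ι} (hA₀ : A₀ ∈ T) {r : ℝ} (hr : 0 < r)
    (hball : ∀ A ∈ T, ∑ i ∈ symmDiff A A₀, γ i ^ 2 ≤ r ^ 2) (a : (ι → ℤˣ) → Finset ι)
    (ha : ∀ ξ, a ξ ∈ T) :
    signMean (fun ξ => ∑ i, ((ξ i : ℤ) : ℝ) * (γ i * setSign (a ξ) i)) ≤
      40 * r * √(D * (1 + Real.log (1 + (∑ i, γ i ^ 2) / r ^ 2))) := by
  set W := ∑ i, γ i ^ 2 with hW
  have hW0 : 0 ≤ W := Finset.sum_nonneg fun i _ => sq_nonneg _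
  set y := W / r ^ 2 with hy
  have hy0 : 0 ≤ y := by positivity
  set G := 1 + Real.log (1 + y) with hG
  have hlog0 : 0 ≤ Real.log (1 + y) := Real.log_nonneg (by linarith)
  have hG1 : 1 ≤ G := by linarith
  have hD1' : (1 : ℝ) ≤ D := by exact_mod_cast hD1
  have hDG : 0 < D * G := by positivity
  -- Halving the radius multiplies W/δ by 4, so the log-cardinality of the nets grows linearly in
  -- `k`. The net at scale 0 is the single centre, whose signed sum has mean zero.
  have hnet : ∀ k : ℕ, ∃ N ⊆ T, (N.card : ℝ) ≤ Real.exp (D * G * (3 * k + 4)) ∧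
      (∀ A ∈ T, ∃ B ∈ N, ∑ i ∈ symmDiff A B, γ i ^ 2 ≤ (r * (1 / 2) ^ k) ^ 2) ∧
      (k = 0 → N = {A₀}) := by
    intro k
    rcases Nat.eq_zero_or_pos k with rfl | hk
    · refine ⟨{A₀}, by simpa using hA₀, ?_, fun A hA => ⟨A₀, by simp, ?_⟩, fun _ => rfl⟩
      · simp only [Finset.card_singleton, Nat.cast_one]
        exact Real.one_le_exp (by positivity)
      · simpa using hball A hA
    · obtain ⟨N, hNT, hsep, hcov⟩ := exists_separated_net T (fun i => γ i ^ 2)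
        (δ := (r * (1 / 2) ^ k) ^ 2) (by positivity)
      refine ⟨N, hNT, ?_, hcov, fun h => by omega⟩
      refine (log_card_le_of_separated N (fun i => γ i ^ 2) (fun i => sq_nonneg _) (by positivity)
        ((Finset.vcDim_mono hNT).trans hD) hsep).trans (Real.exp_le_exp.2 ?_)
      have h1 : 4 + 4 * W / (r * (1 / 2) ^ k) ^ 2 ≤ 4 ^ (k + 1) * (1 + y) := by
        have e : 4 * W / (r * (1 / 2) ^ k) ^ 2 = 4 ^ (k + 1) * y := by
          have : ((1 / 2 : ℝ) ^ k) ^ 2 * 4 ^ k = 1 := by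
            rw [← pow_mul, mul_comm k 2, pow_mul, ← mul_pow]; norm_num
          rw [hy, mul_pow, div_eq_iff (by positivity), pow_succ]
          calc 4 * W = 4 * W * (r ^ 2 / r ^ 2) * (((1 / 2 : ℝ) ^ k) ^ 2 * 4 ^ k) := by
                rw [this, div_self (by positivity)]; ring
            _ = _ := by ring
        have h4 : (4 : ℝ) ≤ 4 ^ (k + 1) := by
          rw [pow_succ]
          have : (1 : ℝ) ≤ 4 ^ k := one_le_pow₀ (by norm_num)
          linarith
        rw [e]; linarith
      have h2 : Real.log (4 + 4 * W / (r * (1 / 2) ^ k) ^ 2)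
          ≤ (k + 1) * (3 / 2) + Real.log (1 + y) := by
        refine (Real.log_le_log (by positivity) h1).trans ?_
        rw [Real.log_mul (by positivity) (by positivity), Real.log_pow]
        have : Real.log 4 ≤ 3 / 2 := by
          rw [show (4 : ℝ) = 2 ^ 2 by norm_num, Real.log_pow]
          have := Real.log_two_lt_d9
          push_cast
          linarith
        push_cast
        gcongr
      calc 2 * D * Real.log (4 + 4 * W / (r * (1 / 2) ^ k) ^ 2) + 1 / 2
          ≤ 2 * D * ((k + 1) * (3 / 2) + Real.log (1 + y)) + D := by
            gcongr; linarith
        _ = D * ((3 * k + 4) + 2 * Real.log (1 + y)) := by ring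
        _ ≤ D * ((3 * k + 4) + (3 * k + 4) * Real.log (1 + y)) := by
            have : (0 : ℝ) ≤ k := Nat.cast_nonneg k
            gcongr
            linarith
        _ = _ := by rw [hG]; ring
  choose N hNT hcard hcov hN0 using hnet
  have hproj : ∀ k : ℕ, ∃ p : Finset ι → Finset ι, ∀ A ∈ T, p A ∈ N k ∧
      ∑ i ∈ symmDiff A (p A), γ i ^ 2 ≤ (r * (1 / 2) ^ k) ^ 2 := by
    intro k
    choose! p hp using hcov k
    exact ⟨p, hp⟩
  choose p hp using hproj
  -- The last factor is the closed form of ∑ (3j + 7) 2^(-j) over j < k, the accumulated cost of the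
  -- links.
  have hind : ∀ k : ℕ, ∀ b : (ι → ℤˣ) → Finset ι, (∀ ξ, b ξ ∈ N k) →
      signMean (fun ξ => ∑ i, ((ξ i : ℤ) : ℝ) * (γ i * setSign (b ξ) i)) ≤
        2 * r * √(D * G) * (20 - (6 * k + 20) * (1 / 2) ^ k) := by
    intro k
    induction k with
    | zero =>
      intro b hb
      have : ∀ ξ, b ξ = A₀ := fun ξ => by simpa [hN0 0 rfl] using hb ξ
      simp only [this, signMean_sum_const]
      simp
    | succ k ih =>
      intro b hb
      refine (signMean_chain_step (N (k + 1)) γ (ρ := r * (1 / 2) ^ k) (by positivity)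
        (ℓ := D * G * (3 * k + 7)) (by positivity) ?_ (p k)
        (fun A hA => (hp k A (hNT _ hA)).2) b hb).trans ?_
      · refine (hcard (k + 1)).trans (Real.exp_le_exp.2 (le_of_eq ?_))
        push_cast; ring
      · have h1 := ih (fun ξ => p k (b ξ)) fun ξ => (hp k _ (hNT _ (hb ξ))).1
        have h2 : √(2 * (D * G * (3 * k + 7))) ≤ √(D * G) * (3 * k + 7) := by
          have : (0 : ℝ) ≤ k := Nat.cast_nonneg k
          refine Real.sqrt_le_iff.2 ⟨by positivity, ?_⟩
          rw [mul_pow, Real.sq_sqrt hDG.le]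
          calc 2 * (D * G * (3 * k + 7)) = D * G * (2 * (3 * k + 7)) := by ring
            _ ≤ D * G * (3 * k + 7) ^ 2 := by gcongr; nlinarith
        calc _ ≤ 2 * r * √(D * G) * (20 - (6 * k + 20) * (1 / 2) ^ k)
              + 2 * (r * (1 / 2) ^ k) * (√(D * G) * (3 * k + 7)) := by gcongr
          _ = _ := by push_cast; ring
  -- The link from `T` to the net at scale `k` uses only the crude bound |T| ≤ exp |T|. As `T` is
  -- fixed and finite, its cost vanishes as `k` grows.
  have hfin : ∀ k : ℕ, signMean (fun ξ => ∑ i, ((ξ i : ℤ) : ℝ) * (γ i * setSign (a ξ) i)) ≤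
      40 * r * √(D * G) + 2 * (r * (1 / 2) ^ k) * √(2 * T.card) := by
    intro k
    have hTpos : (0 : ℝ) < T.card := by exact_mod_cast Finset.card_pos.2 ⟨_, hA₀⟩
    refine (signMean_chain_step T γ (ρ := r * (1 / 2) ^ k) (by positivity)
        (ℓ := T.card) hTpos ?_ (p k)
        (fun A hA => (hp k A hA).2) a ha).trans ?_
    · linarith [Real.add_one_le_exp (T.card : ℝ)]
    · have h1 := hind k (fun ξ => p k (a ξ)) fun ξ => (hp k _ (ha ξ)).1
      have h2 : 0 ≤ 2 * r * √(D * G) * ((6 * k + 20) * (1 / 2) ^ k) := by positivity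
      linarith
  refine ge_of_tendsto' (f := fun k : ℕ => 40 * r * √(D * G)
    + 2 * (r * (1 / 2) ^ k) * √(2 * T.card)) (x := atTop) ?_ hfin
  have h0 : Tendsto (fun k : ℕ => ((1 : ℝ) / 2) ^ k) atTop (nhds 0) :=
    tendsto_pow_atTop_nhds_zero_of_lt_one (by norm_num) (by norm_num)
  have := ((h0.const_mul r).const_mul 2).mul_const √(2 * (T.card : ℝ))
  simpa using this.const_add (40 * r * √(D * G))

end Chaining

/-! ### Symmetrization of empirical processes in expectation. -/

theorem integral_comp_measurePreserving {α β : Type*} [MeasurableSpace α] [MeasurableSpace β]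
    {μ : Measure α} {ν : Measure β} {f : α → β} (hf : MeasurePreserving f μ ν) {g : β → ℝ}
    (hg : AEStronglyMeasurable g ν) : ∫ x, g (f x) ∂μ = ∫ y, g y ∂ν := by
  rw [← hf.map_eq] at hg ⊢
  exact (integral_map hf.measurable.aemeasurable hg).symm

theorem integrable_finset_sup' {α κ : Type*} [MeasurableSpace α] {μ : Measure α} {F : Finset κ}
    (hF : F.Nonempty) {f : κ → α → ℝ} (hf : ∀ k ∈ F, Integrable (f k) μ) :
    Integrable (fun x => F.sup' hF fun k => f k x) μ := by
  induction hF using Finset.Nonempty.cons_induction with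
  | singleton a => simpa using hf a (by simp)
  | cons a s ha hs ih =>
    simp only [Finset.sup'_cons hs]
    exact (hf a (by simp)).sup (ih fun k hk => hf k (by simp [hk]))

section Symmetrization

variable {O κ : Type*} [MeasurableSpace O]

/-- The population mean is the average over an independent copy of the sample, and a maximum of
averages is at most the average of the maximum. -/
theorem integral_sup'_sub_le_ghost (μ : Measure O) [IsProbabilityMeasure μ] (n : ℕ) {F : Finset κ}
    (hF : F.Nonempty) {h : κ → O → ℝ} (hi : ∀ k, Integrable (h k) μ) :
    ∫ ω : Fin n → O, F.sup' hF (fun k => ∑ i, h k (ω i) - n * ∫ o, h k o ∂μ)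
        ∂(Measure.pi fun _ => μ)
      ≤ ∫ p : Fin n → O × O, F.sup' hF (fun k => ∑ i, (h k (p i).1 - h k (p i).2))
        ∂(Measure.pi fun _ => μ.prod μ) := by
  have hev : ∀ (i : Fin n), MeasurePreserving (fun ω : Fin n → O => ω i)
      (Measure.pi fun _ => μ) μ := fun i => measurePreserving_eval (fun _ => μ) i
  have hie : ∀ k (i : Fin n), Integrable (fun ω : Fin n → O => h k (ω i))
      (Measure.pi fun _ => μ) := fun k i => (hev i).integrable_comp_of_integrable (hi k)
  set P : Measure (Fin n → O) := Measure.pi fun _ => μ with hP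
  have e1 : ∫ p : Fin n → O × O, F.sup' hF (fun k => ∑ i, (h k (p i).1 - h k (p i).2))
        ∂(Measure.pi fun _ => μ.prod μ)
      = ∫ q : (Fin n → O) × (Fin n → O), F.sup' hF (fun k => ∑ i, (h k (q.1 i) - h k (q.2 i)))
        ∂(P.prod P) :=
    (measurePreserving_arrowProdEquivProdArrow O O (Fin n) (fun _ => μ)
      fun _ => μ).integral_comp'
      (fun q : (Fin n → O) × (Fin n → O) => F.sup' hF (fun k => ∑ i, (h k (q.1 i) - h k (q.2 i))))
  have hint : Integrable (fun q : (Fin n → O) × (Fin n → O) =>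
      F.sup' hF (fun k => ∑ i, (h k (q.1 i) - h k (q.2 i)))) (P.prod P) := by
    refine integrable_finset_sup' hF fun k _ => integrable_finsetSum _ fun i _ => ?_
    exact ((hie k i).comp_fst P).sub ((hie k i).comp_snd P)
  rw [e1, integral_prod _ hint]
  refine integral_mono_ae ?_ hint.integral_prod_left ?_
  · exact integrable_finset_sup' hF fun k _ =>
      (integrable_finsetSum _ fun i _ => hie k i).sub (integrable_const _)
  · filter_upwards [hint.prod_right_ae] with ω hω
    refine Finset.sup'_le hF _ fun k hk => ?_
    have hid : ∀ i : Fin n, Integrable (fun ω' : Fin n → O => h k (ω i) - h k (ω' i)) P :=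
      fun i => (integrable_const _).sub (hie k i)
    have e2 : ∑ i, h k (ω i) - n * ∫ o, h k o ∂μ
        = ∫ ω' : Fin n → O, ∑ i, (h k (ω i) - h k (ω' i)) ∂P := by
      rw [integral_finsetSum _ fun i _ => hid i]
      have : ∀ i : Fin n, ∫ ω' : Fin n → O, (h k (ω i) - h k (ω' i)) ∂P
          = h k (ω i) - ∫ o, h k o ∂μ := fun i => by
        rw [integral_sub (integrable_const _) (hie k i),
          integral_comp_measurePreserving (hev i) (hi k).aestronglyMeasurable]
        simp
      simp [this, Finset.sum_sub_distrib]
    rw [e2]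
    refine integral_mono (integrable_finsetSum _ fun i _ => hid i)
      hω fun ω' => ?_
    exact Finset.le_sup' (fun k => ∑ i, (h k (ω i) - h k (ω' i))) hk

/-- Swapping the two observations in the pairs that carry the sign -1 preserves the product law. -/
theorem integral_sup'_signed_eq (μ : Measure O) [IsProbabilityMeasure μ] (n : ℕ) {F : Finset κ}
    (hF : F.Nonempty) {h : κ → O → ℝ} (hi : ∀ k, Integrable (h k) μ) (ξ : Fin n → ℤˣ) :
    ∫ p : Fin n → O × O, F.sup' hF (fun k => ∑ i, ((ξ i : ℤ) : ℝ) * (h k (p i).1 - h k (p i).2))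
        ∂(Measure.pi fun _ => μ.prod μ)
      = ∫ p : Fin n → O × O, F.sup' hF (fun k => ∑ i, (h k (p i).1 - h k (p i).2))
        ∂(Measure.pi fun _ => μ.prod μ) := by
  have hev : ∀ (i : Fin n), MeasurePreserving (fun ω : Fin n → O × O => ω i)
      (Measure.pi fun _ => μ.prod μ) (μ.prod μ) := fun i =>
    measurePreserving_eval (fun _ => μ.prod μ) i
  have hT : MeasurePreserving
      (fun (p : Fin n → O × O) i => (fun q : O × O => if ξ i = 1 then q else q.swap) (p i))
      (Measure.pi fun _ => μ.prod μ) (Measure.pi fun _ => μ.prod μ) := by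
    refine measurePreserving_pi (fun _ => μ.prod μ) (fun _ => μ.prod μ)
      (f := fun i => fun q : O × O => if ξ i = 1 then q else q.swap) fun i => ?_
    by_cases hξ : ξ i = 1
    · simp only [hξ, if_true]
      exact MeasurePreserving.id (μ.prod μ)
    · simpa [hξ] using Measure.measurePreserving_swap (μ := μ) (ν := μ)
  rw [← integral_comp_measurePreserving hT
    (g := fun p => F.sup' hF (fun k => ∑ i, (h k (p i).1 - h k (p i).2)))]
  · refine integral_congr_ae (Eventually.of_forall fun p => ?_)
    refine Finset.sup'_congr hF rfl fun k _ => Finset.sum_congr rfl fun i _ => ?_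
    rcases Int.units_eq_one_or (ξ i) with hξ | hξ <;> simp [hξ]
  · refine (integrable_finset_sup' hF fun k _ => integrable_finsetSum _ fun i _ => ?_).1
    exact ((hev i).integrable_comp_of_integrable ((hi k).comp_fst μ)).sub
      ((hev i).integrable_comp_of_integrable ((hi k).comp_snd μ))

theorem signMean_sup'_le {n : ℕ} {F : Finset κ} (hF : F.Nonempty) (u : κ → Fin n → ℝ) {y : ℝ}
    (hy : ∀ a : (Fin n → ℤˣ) → κ, (∀ ξ, a ξ ∈ F) →
      signMean (fun ξ => ∑ i, ((ξ i : ℤ) : ℝ) * u (a ξ) i) ≤ y) :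
    signMean (fun ξ => F.sup' hF fun k => ∑ i, ((ξ i : ℤ) : ℝ) * u k i) ≤ y := by
  have : ∀ ξ : Fin n → ℤˣ, ∃ k ∈ F, (F.sup' hF fun k => ∑ i, ((ξ i : ℤ) : ℝ) * u k i)
      = ∑ i, ((ξ i : ℤ) : ℝ) * u k i := fun ξ => Finset.exists_mem_eq_sup' hF _
  choose a ha hEq using this
  simp only [hEq]
  exact hy a ha

/-- Symmetrization: a bound for the conditional Rademacher averages, linear in an empirical mean,
bounds the expected one-sided deviation of the empirical process. -/
theorem integral_sup'_sub_le (μ : Measure O) [IsProbabilityMeasure μ] (n : ℕ) {F : Finset κ}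
    (hF : F.Nonempty) {h : κ → O → ℝ} (hi : ∀ k, Integrable (h k) μ) {G : O → ℝ}
    (hG : Integrable G μ) (b c : ℝ)
    (hR : ∀ (ω : Fin n → O) (a : (Fin n → ℤˣ) → κ), (∀ ξ, a ξ ∈ F) →
      signMean (fun ξ => ∑ i, ((ξ i : ℤ) : ℝ) * h (a ξ) (ω i)) ≤ b + c * ∑ i, G (ω i)) :
    ∫ ω : Fin n → O, F.sup' hF (fun k => ∑ i, h k (ω i) - n * ∫ o, h k o ∂μ)
        ∂(Measure.pi fun _ => μ) ≤ 2 * (b + c * (n * ∫ o, G o ∂μ)) := by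
  have hev : ∀ (i : Fin n), MeasurePreserving (fun ω : Fin n → O × O => ω i)
      (Measure.pi fun _ => μ.prod μ) (μ.prod μ) := fun i =>
    measurePreserving_eval (fun _ => μ.prod μ) i
  have hint1 : ∀ {f : O → ℝ} (_ : Integrable f μ) (i : Fin n), Integrable
      (fun p : Fin n → O × O => f (p i).1) (Measure.pi fun _ => μ.prod μ) := fun hf i =>
    (hev i).integrable_comp_of_integrable (hf.comp_fst μ)
  have hint2 : ∀ {f : O → ℝ} (_ : Integrable f μ) (i : Fin n), Integrable
      (fun p : Fin n → O × O => f (p i).2) (Measure.pi fun _ => μ.prod μ) := fun hf i =>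
    (hev i).integrable_comp_of_integrable (hf.comp_snd μ)
  refine (integral_sup'_sub_le_ghost μ n hF hi).trans ?_
  have hsup : ∀ ξ : Fin n → ℤˣ, Integrable (fun p : Fin n → O × O => F.sup' hF
      (fun k => ∑ i, ((ξ i : ℤ) : ℝ) * (h k (p i).1 - h k (p i).2)))
      (Measure.pi fun _ => μ.prod μ) := fun ξ =>
    integrable_finset_sup' hF fun k _ => integrable_finsetSum _ fun i _ =>
      ((hint1 (hi k) i).sub (hint2 (hi k) i)).const_mul _
  have e : ∫ p : Fin n → O × O, F.sup' hF (fun k => ∑ i, (h k (p i).1 - h k (p i).2))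
        ∂(Measure.pi fun _ => μ.prod μ)
      = ∫ p : Fin n → O × O, signMean (fun ξ => F.sup' hF
          (fun k => ∑ i, ((ξ i : ℤ) : ℝ) * (h k (p i).1 - h k (p i).2)))
        ∂(Measure.pi fun _ => μ.prod μ) := by
    simp only [signMean]
    rw [integral_const_mul, integral_finsetSum _ fun ξ _ => hsup ξ]
    simp only [integral_sup'_signed_eq μ n hF hi]
    exact (signMean_const (ι := Fin n) _).symm
  rw [e]
  -- The sign law is symmetric, so the ghost half may be averaged over -ξ; each half is then an
  -- ordinary Rademacher supremum.
  have hpt : ∀ p : Fin n → O × O, signMean (fun ξ => F.sup' hF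
          (fun k => ∑ i, ((ξ i : ℤ) : ℝ) * (h k (p i).1 - h k (p i).2)))
      ≤ 2 * b + c * (∑ i, G (p i).1 + ∑ i, G (p i).2) := by
    intro p
    have h1 := signMean_sup'_le hF (fun k i => h k (p i).1) (hR fun i => (p i).1)
    have h2 := signMean_sup'_le hF (fun k i => h k (p i).2) (hR fun i => (p i).2)
    rw [← signMean_neg] at h2
    calc _ ≤ signMean (fun ξ : Fin n → ℤˣ =>
            (F.sup' hF fun k => ∑ i, ((ξ i : ℤ) : ℝ) * h k (p i).1)
            + (F.sup' hF fun k => ∑ i, (((-ξ) i : ℤ) : ℝ) * h k (p i).2)) := by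
          refine signMean_mono fun ξ => Finset.sup'_le hF _ fun k hk => ?_
          have h3 := Finset.le_sup' (fun k => ∑ i, ((ξ i : ℤ) : ℝ) * h k (p i).1) hk
          have h4 := Finset.le_sup' (fun k => ∑ i, (((-ξ) i : ℤ) : ℝ) * h k (p i).2) hk
          refine le_trans (le_of_eq ?_) (add_le_add h3 h4)
          rw [← Finset.sum_add_distrib]
          refine Finset.sum_congr rfl fun i _ => ?_
          simp; ring
      _ ≤ _ := by rw [signMean_add]; linarith
  have hG1 : Integrable (fun p : Fin n → O × O => ∑ i, G (p i).1)
      (Measure.pi fun _ => μ.prod μ) := integrable_finsetSum _ fun i _ => hint1 hG i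
  have hG2 : Integrable (fun p : Fin n → O × O => ∑ i, G (p i).2)
      (Measure.pi fun _ => μ.prod μ) := integrable_finsetSum _ fun i _ => hint2 hG i
  refine (integral_mono ?_ ((integrable_const (2 * b)).add ((hG1.add hG2).const_mul c)) hpt).trans
    (le_of_eq ?_)
  · simp only [signMean]
    exact (integrable_finsetSum _ fun ξ _ => hsup ξ).const_mul _
  · have e1 : ∀ i : Fin n, ∫ p : Fin n → O × O, G (p i).1 ∂(Measure.pi fun _ => μ.prod μ)
        = ∫ o, G o ∂μ := fun i =>
      integral_comp_measurePreserving (measurePreserving_fst.comp (hev i)) hG.aestronglyMeasurable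
    have e2 : ∀ i : Fin n, ∫ p : Fin n → O × O, G (p i).2 ∂(Measure.pi fun _ => μ.prod μ)
        = ∫ o, G o ∂μ := fun i =>
      integral_comp_measurePreserving (measurePreserving_snd.comp (hev i)) hG.aestronglyMeasurable
    have hG12 : Integrable (fun p : Fin n → O × O => c * (∑ i, G (p i).1 + ∑ i, G (p i).2))
        (Measure.pi fun _ => μ.prod μ) := (hG1.add hG2).const_mul c
    simp only [Pi.add_apply]
    rw [integral_add (integrable_const _) hG12, integral_const_mul c,
      integral_add hG1 hG2, integral_finsetSum _ fun i _ => hint1 hG i,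
      integral_finsetSum _ fun i _ => hint2 hG i]
    simp only [e1, e2]
    simp
    ring

end Symmetrization

/-! ### Moments of the score and the mean-square geometry of the slice. -/

/-- Fourth moments are controlled by subgaussian tails. -/
theorem exists_integral_pow_four_le (Cν ν : ℝ) (hC : 0 < Cν) (hν : 0 < ν) :
    ∃ K : ℝ, 0 < K ∧ ∀ {α : Type*} [MeasurableSpace α] (μ : Measure α) [IsProbabilityMeasure μ]
      (f : α → ℝ), Measurable f →
      (∀ t : ℝ, 0 < t → μ.real {x | t < |f x|} ≤ Cν * Real.exp (-ν * t ^ 2)) →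
      Integrable (fun x => f x ^ 4) μ ∧ ∫ x, f x ^ 4 ∂μ ≤ K := by
  have hint : Integrable (fun t : ℝ => 4 * Cν * (t ^ (3 : ℝ) * Real.exp (-ν * t ^ 2)))
      (volume.restrict (Set.Ioi 0)) :=
    ((integrable_rpow_mul_exp_neg_mul_sq hν (by norm_num : (-1 : ℝ) < 3)).const_mul _).restrict
  have hnn : 0 ≤ᵐ[volume.restrict (Set.Ioi 0)]
      fun t : ℝ => 4 * Cν * (t ^ (3 : ℝ) * Real.exp (-ν * t ^ 2)) := by
    filter_upwards [ae_restrict_mem measurableSet_Ioi] with t ht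
    have : (0 : ℝ) ≤ t ^ (3 : ℝ) := Real.rpow_nonneg (le_of_lt ht) _
    simp only [Pi.zero_apply]
    positivity
  -- The layer-cake formula bounds the fourth moment by this integral, which depends on the tail
  -- constants only and so is uniform in the sample size. The 1 is added for strict positivity.
  refine ⟨(∫ t in Set.Ioi (0 : ℝ), 4 * Cν * (t ^ (3 : ℝ) * Real.exp (-ν * t ^ 2))) + 1, ?_, ?_⟩
  · have := integral_nonneg_of_ae hnn
    linarith
  intro α _ μ _ f hf htail
  have key : ∫⁻ x, ENNReal.ofReal (f x ^ 4) ∂μ ≤ ENNReal.ofReal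
      (∫ t in Set.Ioi (0 : ℝ), 4 * Cν * (t ^ (3 : ℝ) * Real.exp (-ν * t ^ 2))) := by
    have h := lintegral_rpow_eq_lintegral_meas_lt_mul μ (f := fun x => |f x|)
      (Eventually.of_forall fun x => abs_nonneg _) hf.abs.aemeasurable (p := 4) (by norm_num)
    have e : ∀ x, |f x| ^ (4 : ℝ) = f x ^ 4 := fun x => by
      rw [show (4 : ℝ) = ((4 : ℕ) : ℝ) by norm_num, Real.rpow_natCast, Even.pow_abs (by decide)]
    simp only [e] at h
    rw [h, ofReal_integral_eq_lintegral_ofReal hint hnn, ← lintegral_const_mul']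
    · refine setLIntegral_mono_ae' measurableSet_Ioi (Eventually.of_forall fun t ht => ?_)
      have ht0 : (0 : ℝ) < t := ht
      have h1 : μ {x | t < |f x|} ≤ ENNReal.ofReal (Cν * Real.exp (-ν * t ^ 2)) := by
        rw [← ENNReal.ofReal_toReal (measure_ne_top μ {x | t < |f x|})]
        exact ENNReal.ofReal_le_ofReal (htail t ht0)
      calc ENNReal.ofReal 4 * (μ {x | t < |f x|} * ENNReal.ofReal (t ^ ((4 : ℝ) - 1)))
          ≤ ENNReal.ofReal 4 * (ENNReal.ofReal (Cν * Real.exp (-ν * t ^ 2))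
            * ENNReal.ofReal (t ^ ((4 : ℝ) - 1))) := by gcongr
        _ = _ := by
          rw [← ENNReal.ofReal_mul (by positivity), ← ENNReal.ofReal_mul (by norm_num),
            show (4 : ℝ) - 1 = 3 by norm_num]
          congr 1
          ring
    · exact ENNReal.ofReal_ne_top
  have hi : Integrable (fun x => f x ^ 4) μ := by
    refine ⟨(hf.pow_const 4).aestronglyMeasurable, ?_⟩
    rw [hasFiniteIntegral_iff_ofReal (Eventually.of_forall fun x => by positivity)]
    exact key.trans_lt ENNReal.ofReal_lt_top
  refine ⟨hi, ?_⟩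
  rw [← ofReal_integral_eq_lintegral_ofReal hi (Eventually.of_forall fun x => by positivity),
    ENNReal.ofReal_le_ofReal_iff (integral_nonneg_of_ae hnn)] at key
  linarith

theorem signTreat_eq {𝒳 : Type*} (π : 𝒳 → Bool) (x : 𝒳) :
    signTreat π x = if π x then 1 else -1 := by
  unfold signTreat treat
  split_ifs <;> norm_num

theorem signTreat_sq {𝒳 : Type*} (π : 𝒳 → Bool) (x : 𝒳) : signTreat π x ^ 2 = 1 := by
  rw [signTreat_eq]; split_ifs <;> norm_num

theorem measurable_treat {𝒳 : Type*} [MeasurableSpace 𝒳] {π : 𝒳 → Bool} (hπ : Measurable π) :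
    Measurable (treat π) :=
  (measurable_of_countable fun b : Bool => if b then (1 : ℝ) else 0).comp hπ

theorem measurable_signTreat {𝒳 : Type*} [MeasurableSpace 𝒳] {π : 𝒳 → Bool} (hπ : Measurable π) :
    Measurable (signTreat π) :=
  ((measurable_treat hπ).const_mul 2).sub_const 1

namespace PolicyModel

variable {𝒳 𝒵 𝒲 : Type*} [MeasurableSpace 𝒳] [MeasurableSpace 𝒵] [MeasurableSpace 𝒲]
  (M : PolicyModel 𝒳 𝒵 𝒲)

theorem measurable_score : Measurable M.score := by
  have h1 : Measurable fun o : Obs 𝒳 𝒵 𝒲 => M.g o.1 o.2.1 :=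
    M.measurable_g.comp (measurable_fst.prodMk (measurable_fst.comp measurable_snd))
  have h2 : Measurable fun o : Obs 𝒳 𝒵 𝒲 => M.m o.1 o.2.2.1 :=
    M.measurable_m.comp (measurable_fst.prodMk
      (measurable_fst.comp (measurable_snd.comp measurable_snd)))
  have h3 : Measurable fun o : Obs 𝒳 𝒵 𝒲 => o.2.2.2 :=
    measurable_snd.comp (measurable_snd.comp measurable_snd)
  exact (M.measurable_τ.comp measurable_fst).add (h1.mul (h3.sub h2))

/-- The signed score `(2 π(X) - 1) Γ`. -/
noncomputable def signedScore (π : 𝒳 → Bool) (o : Obs 𝒳 𝒵 𝒲) : ℝ := signTreat π o.1 * M.score o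

/-- The squared score on the event that the two policies disagree. -/
noncomputable def disagreement (π π' : 𝒳 → Bool) (o : Obs 𝒳 𝒵 𝒲) : ℝ :=
  if π o.1 = π' o.1 then 0 else M.score o ^ 2

theorem disagreement_nonneg (π π' : 𝒳 → Bool) (o : Obs 𝒳 𝒵 𝒲) : 0 ≤ M.disagreement π π' o := by
  unfold disagreement; split_ifs <;> positivity

theorem disagreement_le (π π' : 𝒳 → Bool) (o : Obs 𝒳 𝒵 𝒲) :
    M.disagreement π π' o ≤ M.score o ^ 2 := by
  unfold disagreement; split_ifs <;> [positivity; exact le_rfl]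

theorem signedScore_sq (π : 𝒳 → Bool) (o : Obs 𝒳 𝒵 𝒲) :
    M.signedScore π o ^ 2 = M.score o ^ 2 := by
  rw [signedScore, mul_pow, signTreat_sq, one_mul]

/-- On disagreement the signed scores are Γ and -Γ, and ((Γ - a)² + (Γ + a)²)/2 = Γ² + a². The
freedom in `a` allows centering at the optimal improvement. -/
theorem disagreement_le_of_center (π π' : 𝒳 → Bool) (a : ℝ) (o : Obs 𝒳 𝒵 𝒲) :
    M.disagreement π π' o ≤
      ((M.signedScore π o - a) ^ 2 + (M.signedScore π' o - a) ^ 2) / 2 := by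
  unfold disagreement signedScore
  rw [signTreat_eq, signTreat_eq]
  cases π o.1 <;> cases π' o.1 <;> simp <;> nlinarith [sq_nonneg a]

variable {M} in
theorem measurable_signedScore {π : 𝒳 → Bool} (hπ : Measurable π) :
    Measurable (M.signedScore π) :=
  ((measurable_signTreat hπ).comp measurable_fst).mul M.measurable_score

variable {M} in
theorem measurable_disagreement {π π' : 𝒳 → Bool} (hπ : Measurable π) (hπ' : Measurable π') :
    Measurable (M.disagreement π π') := by
  refine Measurable.ite ?_ measurable_const (M.measurable_score.pow_const 2)
  exact measurableSet_eq_fun (hπ.comp measurable_fst) (hπ'.comp measurable_fst)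

section Moments

variable {M}

theorem integrable_score_sq (h4 : Integrable (fun o => M.score o ^ 4) M.law) :
    Integrable (fun o => M.score o ^ 2) M.law := by
  refine ((integrable_const 1).add h4).mono' (M.measurable_score.pow_const 2).aestronglyMeasurable
    (Eventually.of_forall fun o => ?_)
  rw [Real.norm_of_nonneg (by positivity)]
  simp only [Pi.add_apply]
  nlinarith [sq_nonneg (M.score o ^ 2 - 1), sq_nonneg (M.score o)]

theorem memLp_signedScore (h4 : Integrable (fun o => M.score o ^ 4) M.law)
    {π : 𝒳 → Bool} (hπ : Measurable π) :
    MemLp (M.signedScore π) 2 M.law := by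
  rw [memLp_two_iff_integrable_sq (measurable_signedScore hπ).aestronglyMeasurable]
  simpa only [signedScore_sq] using integrable_score_sq h4

theorem integrable_disagreement (h4 : Integrable (fun o => M.score o ^ 4) M.law)
    {π π' : 𝒳 → Bool} (hπ : Measurable π) (hπ' : Measurable π') :
    Integrable (M.disagreement π π') M.law := by
  refine (integrable_score_sq h4).mono' (measurable_disagreement hπ hπ').aestronglyMeasurable
    (Eventually.of_forall fun o => ?_)
  rw [Real.norm_of_nonneg (M.disagreement_nonneg _ _ _)]
  exact M.disagreement_le _ _ _

theorem integrable_score (h4 : Integrable (fun o => M.score o ^ 4) M.law) :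
    Integrable M.score M.law :=
  ((memLp_two_iff_integrable_sq M.measurable_score.aestronglyMeasurable).2
    (integrable_score_sq h4)).integrable (by norm_num)

theorem variance_signedScore_le (h4 : Integrable (fun o => M.score o ^ 4) M.law)
    {π : 𝒳 → Bool} (hπ : Measurable π) :
    ProbabilityTheory.variance (M.signedScore π) M.law ≤ M.scoreSecondMoment := by
  rw [ProbabilityTheory.variance_eq_sub (memLp_signedScore h4 hπ)]
  have : ∫ o, (M.signedScore π ^ 2) o ∂M.law = M.scoreSecondMoment := by
    simp only [Pi.pow_apply, signedScore_sq]; rfl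
  rw [this]
  nlinarith [sq_nonneg (∫ o, M.signedScore π o ∂M.law)]

theorem variance_oracleEstimate (h4 : Integrable (fun o => M.score o ^ 4) M.law)
    {n : ℕ} (hn : 1 ≤ n) {π : 𝒳 → Bool} (hπ : Measurable π) :
    ProbabilityTheory.variance (M.oracleEstimate n π) (M.sampleLaw n)
      = (n : ℝ)⁻¹ * ProbabilityTheory.variance (M.signedScore π) M.law := by
  have h := ProbabilityTheory.variance_sum_pi (ι := Fin n) (Ω := fun _ => Obs 𝒳 𝒵 𝒲)
    (μ := fun _ => M.law) (X := fun _ => M.signedScore π) fun _ => memLp_signedScore h4 hπ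
  have e : M.oracleEstimate n π
      = fun ω => (n : ℝ)⁻¹ * (∑ i, fun ω : Fin n → Obs 𝒳 𝒵 𝒲 => M.signedScore π (ω i)) ω := by
    funext ω
    simp [oracleEstimate, signedScore, Finset.sum_apply]
  rw [e, ProbabilityTheory.variance_const_mul, sampleLaw, h]
  have : (n : ℝ) ≠ 0 := by positivity
  simp
  field_simp

theorem integrable_effect (hid : M.ScoreIdentifies) :
    Integrable (fun o : Obs 𝒳 𝒵 𝒲 => M.τ o.1) M.law :=
  integrable_condExp.congr hid

/-- Conditioning on the features replaces the score by the treatment effect, because the sign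
depends on the features alone. -/
theorem integral_signedScore (h4 : Integrable (fun o => M.score o ^ 4) M.law)
    (hid : M.ScoreIdentifies) {π : 𝒳 → Bool} (hπ : Measurable π) :
    ∫ o, M.signedScore π o ∂M.law = M.advantage π := by
  have hτ := integrable_effect hid
  have hm : MeasurableSpace.comap (fun o : Obs 𝒳 𝒵 𝒲 => o.1) inferInstance ≤
      (inferInstance : MeasurableSpace (Obs 𝒳 𝒵 𝒲)) := measurable_fst.comap_le
  have hs : Measurable[MeasurableSpace.comap (fun o : Obs 𝒳 𝒵 𝒲 => o.1) inferInstance]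
      (fun o : Obs 𝒳 𝒵 𝒲 => signTreat π o.1) :=
    (measurable_signTreat hπ).comp (comap_measurable _)
  have h1 := condExp_mul_of_stronglyMeasurable_left (μ := M.law) hs.stronglyMeasurable
    (g := M.score) ((memLp_signedScore h4 hπ).integrable (by norm_num)) (integrable_score h4)
  have h2 := integral_condExp (μ := M.law) hm
    (f := (fun o : Obs 𝒳 𝒵 𝒲 => signTreat π o.1) * M.score)
  rw [integral_congr_ae h1] at h2
  have h3 : ∫ o, M.signedScore π o ∂M.law = ∫ o, signTreat π o.1 * M.τ o.1 ∂M.law := by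
    refine Eq.trans h2.symm (integral_congr_ae ?_)
    filter_upwards [hid] with o ho
    simp only [Pi.mul_apply, ho]
  have ht : Integrable (fun o : Obs 𝒳 𝒵 𝒲 => treat π o.1 * M.τ o.1) M.law := by
    refine hτ.mono (((measurable_treat hπ).comp measurable_fst).mul
      (M.measurable_τ.comp measurable_fst)).aestronglyMeasurable (Eventually.of_forall fun o => ?_)
    unfold treat
    split_ifs <;> simp
  rw [h3, advantage, value, ← integral_const_mul, ← integral_sub (ht.const_mul 2) hτ]
  refine integral_congr_ae (Eventually.of_forall fun o => ?_)
  simp only [signTreat]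
  ring

theorem bddAbove_value (hid : M.ScoreIdentifies) (P : Set (𝒳 → Bool)) :
    BddAbove (M.value '' P) := by
  refine ⟨∫ o, |M.τ o.1| ∂M.law, ?_⟩
  rintro _ ⟨π, hπ, rfl⟩
  refine (le_abs_self _).trans (abs_integral_le_integral_abs.trans ?_)
  refine integral_mono_of_nonneg (Eventually.of_forall fun o => abs_nonneg _)
    (integrable_effect hid).abs (Eventually.of_forall fun o => ?_)
  simp only [abs_mul, treat]
  split_ifs <;> simp

theorem variance_signedScore_le_sliceVariance
    (h4 : Integrable (fun o => M.score o ^ 4) M.law) {n : ℕ} (hn : 1 ≤ n)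
    {P : Set (𝒳 → Bool)} (hP : ∀ π ∈ P, Measurable π) {lam : ℝ} {π : 𝒳 → Bool}
    (hπ : π ∈ M.slice P lam) :
    ProbabilityTheory.variance (M.signedScore π) M.law ≤ M.sliceVariance n P lam := by
  have hn' : (0 : ℝ) < n := by exact_mod_cast hn
  have hb : BddAbove ((fun π => ProbabilityTheory.variance (M.oracleEstimate n π)
      (M.sampleLaw n)) '' M.slice P lam) := by
    refine ⟨(n : ℝ)⁻¹ * M.scoreSecondMoment, ?_⟩
    rintro _ ⟨π', hπ', rfl⟩
    simp only [variance_oracleEstimate h4 hn (hP _ hπ'.1)]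
    gcongr
    exact variance_signedScore_le h4 (hP _ hπ'.1)
  have := le_csSup hb ⟨π, hπ, rfl⟩
  simp only [variance_oracleEstimate h4 hn (hP _ hπ.1)] at this
  rw [sliceVariance]
  calc ProbabilityTheory.variance (M.signedScore π) M.law
      = n * ((n : ℝ)⁻¹ * ProbabilityTheory.variance (M.signedScore π) M.law) := by field_simp
    _ ≤ _ := by gcongr

theorem sliceVariance_le (h4 : Integrable (fun o => M.score o ^ 4) M.law) {n : ℕ} (hn : 1 ≤ n)
    {P : Set (𝒳 → Bool)} (hP : ∀ π ∈ P, Measurable π) (lam : ℝ) :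
    M.sliceVariance n P lam ≤ M.scoreSecondMoment := by
  have hn' : (0 : ℝ) < n := by exact_mod_cast hn
  have hS : 0 ≤ M.scoreSecondMoment := integral_nonneg fun o => sq_nonneg _
  have : sSup ((fun π => ProbabilityTheory.variance (M.oracleEstimate n π)
      (M.sampleLaw n)) '' M.slice P lam) ≤ (n : ℝ)⁻¹ * M.scoreSecondMoment := by
    refine Real.sSup_le ?_ (by positivity)
    rintro _ ⟨π', hπ', rfl⟩
    simp only [variance_oracleEstimate h4 hn (hP _ hπ'.1)]
    gcongr
    exact variance_signedScore_le h4 (hP _ hπ'.1)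
  rw [sliceVariance]
  calc _ ≤ n * ((n : ℝ)⁻¹ * M.scoreSecondMoment) := by gcongr
    _ = _ := by field_simp

theorem sliceVariance_nonneg (n : ℕ) (P : Set (𝒳 → Bool)) (lam : ℝ) :
    0 ≤ M.sliceVariance n P lam := by
  refine mul_nonneg (Nat.cast_nonneg n) (Real.sSup_nonneg ?_)
  rintro _ ⟨π, -, rfl⟩
  exact ProbabilityTheory.variance_nonneg _ _

/-- Variance plus squared bias: the bias relative to the optimum of the whole class is minus twice
the regret, which lies between 0 and `lam`. -/
theorem integral_signedScore_sub_sq_le (h4 : Integrable (fun o => M.score o ^ 4) M.law)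
    (hid : M.ScoreIdentifies) {n : ℕ} (hn : 1 ≤ n)
    {P : Set (𝒳 → Bool)} (hP : ∀ π ∈ P, Measurable π) {lam : ℝ} {π : 𝒳 → Bool}
    (hπ : π ∈ M.slice P lam) :
    ∫ o, (M.signedScore π o - (2 * sSup (M.value '' P) - ∫ o, M.τ o.1 ∂M.law)) ^ 2 ∂M.law
      ≤ M.sliceVariance n P lam + 4 * lam ^ 2 := by
  have hL := memLp_signedScore h4 (hP _ hπ.1)
  set a := 2 * sSup (M.value '' P) - ∫ o, M.τ o.1 ∂M.law with ha
  have h1 : ∫ o, (M.signedScore π o - a) ^ 2 ∂M.law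
      = ProbabilityTheory.variance (M.signedScore π) M.law + (M.advantage π - a) ^ 2 := by
    have hv := ProbabilityTheory.variance_eq_sub hL
    rw [integral_signedScore h4 hid (hP _ hπ.1)] at hv
    have hi1 := hL.integrable_sq
    have hi2 := hL.integrable (by norm_num)
    have e : ∀ o, (M.signedScore π o - a) ^ 2
        = M.signedScore π o ^ 2 - 2 * a * M.signedScore π o + a ^ 2 := fun o => by ring
    simp only [e]
    have hi3 : Integrable (fun o => 2 * a * M.signedScore π o) M.law := hi2.const_mul _
    have hi4 : Integrable (fun o => M.signedScore π o ^ 2 - 2 * a * M.signedScore π o) M.law :=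
      hi1.sub hi3
    rw [integral_add hi4 (integrable_const _), integral_sub hi1 hi3, integral_const_mul,
      integral_signedScore h4 hid (hP _ hπ.1), hv]
    simp
    ring
  have h2 := variance_signedScore_le_sliceVariance h4 hn hP hπ
  have h3 : M.value π ≤ sSup (M.value '' P) := le_csSup (bddAbove_value hid P) ⟨π, hπ.1, rfl⟩
  have h4 : sSup (M.value '' P) - M.value π ≤ lam := hπ.2
  have h5 : (M.advantage π - a) ^ 2 ≤ 4 * lam ^ 2 := by
    have : M.advantage π - a = -(2 * (sSup (M.value '' P) - M.value π)) := by
      rw [advantage, ha]; ring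
    rw [this]
    nlinarith
  linarith

/-- Two policies of the slice disagree on a set of small second moment of the score. -/
theorem integral_disagreement_le (h4 : Integrable (fun o => M.score o ^ 4) M.law)
    (hid : M.ScoreIdentifies) {n : ℕ} (hn : 1 ≤ n)
    {P : Set (𝒳 → Bool)} (hP : ∀ π ∈ P, Measurable π) {lam : ℝ} {π π' : 𝒳 → Bool}
    (hπ : π ∈ M.slice P lam) (hπ' : π' ∈ M.slice P lam) :
    ∫ o, M.disagreement π π' o ∂M.law ≤ M.sliceVariance n P lam + 4 * lam ^ 2 := by
  have h1 := integral_signedScore_sub_sq_le h4 hid hn hP hπ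
  have h2 := integral_signedScore_sub_sq_le h4 hid hn hP hπ'
  set a := 2 * sSup (M.value '' P) - ∫ o, M.τ o.1 ∂M.law
  have i1 : Integrable (fun o => (M.signedScore π o - a) ^ 2) M.law :=
    ((memLp_signedScore h4 (hP _ hπ.1)).sub (memLp_const a)).integrable_sq
  have i2 : Integrable (fun o => (M.signedScore π' o - a) ^ 2) M.law :=
    ((memLp_signedScore h4 (hP _ hπ'.1)).sub (memLp_const a)).integrable_sq
  have h3 := integral_mono (integrable_disagreement h4 (hP _ hπ.1) (hP _ hπ'.1))
    ((i1.add i2).div_const 2) (M.disagreement_le_of_center π π' a)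
  have h5 : ∫ o, ((M.signedScore π o - a) ^ 2 + (M.signedScore π' o - a) ^ 2) / 2 ∂M.law
      = (∫ o, (M.signedScore π o - a) ^ 2 ∂M.law
        + ∫ o, (M.signedScore π' o - a) ^ 2 ∂M.law) / 2 := by
    rw [integral_div, integral_add i1 i2]
  have h6 : ∫ o, M.disagreement π π' o ∂M.law ≤
      ∫ o, ((M.signedScore π o - a) ^ 2 + (M.signedScore π' o - a) ^ 2) / 2 ∂M.law := h3
  linarith

/-- A sequence of policies close to `π₀` that realizes every sample pattern of the slice. -/
theorem exists_dense_sequence (h4 : Integrable (fun o => M.score o ^ 4) M.law)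
    (hid : M.ScoreIdentifies) {n : ℕ} (hn : 1 ≤ n)
    {P : Set (𝒳 → Bool)} (hP : PointwiseMeasurableClass P) {lam : ℝ}
    (hσ : 0 < M.sliceVariance n P lam + 4 * lam ^ 2) {π₀ : 𝒳 → Bool} (hπ₀ : π₀ ∈ M.slice P lam) :
    ∃ e : ℕ → 𝒳 → Bool, (∀ k, e k ∈ P) ∧
      (∀ k, ∫ o, M.disagreement (e k) π₀ o ∂M.law
        ≤ 2 * (M.sliceVariance n P lam + 4 * lam ^ 2)) ∧
      (∃ k, e k = π₀) ∧
      ∀ π ∈ M.slice P lam, ∀ {m : ℕ} (x : Fin m → 𝒳), ∃ k, ∀ i, e k (x i) = π (x i) := by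
  obtain ⟨hmeas, D, hDP, hDc, hlim⟩ := hP
  set σ := M.sliceVariance n P lam + 4 * lam ^ 2 with hσdef
  -- Approximants of a policy in the slice may leave the slice, so only their distance to `π₀` is
  -- controlled. Slice members lie within σ of `π₀`, disagreement passes to the limit by dominated
  -- convergence, and the factor 2 supplies the strict inequality. `π₀` is adjoined since it need
  -- not belong to `D`.
  set E : Set (𝒳 → Bool) :=
    {π | (π ∈ D ∨ π = π₀) ∧ ∫ o, M.disagreement π π₀ o ∂M.law ≤ 2 * σ} with hE
  have hEc : E.Countable := by
    refine (hDc.union (Set.countable_singleton π₀)).mono ?_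
    rintro π ⟨h | h, -⟩
    · exact Or.inl h
    · exact Or.inr h
  have hself : ∀ o, M.disagreement π₀ π₀ o = 0 := fun o => by simp [disagreement]
  have hE0 : π₀ ∈ E := ⟨Or.inr rfl, by simp only [hself, integral_zero]; linarith⟩
  obtain ⟨e, he⟩ := hEc.exists_eq_range ⟨π₀, hE0⟩
  have heE : ∀ k, e k ∈ E := fun k => he ▸ Set.mem_range_self k
  refine ⟨e, fun k => ?_, fun k => (heE k).2, ?_, fun π hπ m x => ?_⟩
  · rcases (heE k).1 with h | h
    · exact hDP h
    · rw [h]; exact hπ₀.1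
  · rw [he] at hE0; exact hE0
  · obtain ⟨u, huD, hu⟩ := hlim π hπ.1
    have htend : Tendsto (fun k => ∫ o, M.disagreement (u k) π₀ o ∂M.law) atTop
        (nhds (∫ o, M.disagreement π π₀ o ∂M.law)) := by
      refine tendsto_integral_of_dominated_convergence (fun o => M.score o ^ 2)
        (fun k => (measurable_disagreement (hmeas _ (hDP (huD k)))
          (hmeas _ hπ₀.1)).aestronglyMeasurable) (integrable_score_sq h4)
        (fun k => Eventually.of_forall fun o => ?_) (Eventually.of_forall fun o => ?_)
      · rw [Real.norm_of_nonneg (M.disagreement_nonneg _ _ _)]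
        exact M.disagreement_le _ _ _
      · refine tendsto_const_nhds.congr' ?_
        filter_upwards [hu o.1] with k hk
        simp only [disagreement, hk]
    have hlt : ∫ o, M.disagreement π π₀ o ∂M.law < 2 * σ := by
      have := integral_disagreement_le h4 hid hn hmeas hπ hπ₀
      linarith
    have hev : ∀ᶠ k in atTop, ∀ i, u k (x i) = π (x i) :=
      eventually_all.2 fun i => hu (x i)
    obtain ⟨k, hk1, hk2⟩ := ((htend.eventually (gt_mem_nhds hlt)).and hev).exists
    have : u k ∈ E := ⟨Or.inl (huD k), hk1.le⟩
    rw [he] at this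
    obtain ⟨j, hj⟩ := this
    exact ⟨j, fun i => by rw [hj]; exact hk2 i⟩

end Moments

end PolicyModel

/-! ### Sample patterns of policies and their Vapnik-Chervonenkis dimension. -/

section Pattern

variable {𝒳 : Type*}

/-- The set of sample points that the policy treats. -/
def policyPattern {n : ℕ} (π : 𝒳 → Bool) (x : Fin n → 𝒳) : Finset (Fin n) :=
  Finset.univ.filter fun i => π (x i) = true

theorem mem_policyPattern {n : ℕ} (π : 𝒳 → Bool) (x : Fin n → 𝒳) (i : Fin n) :
    i ∈ policyPattern π x ↔ π (x i) = true := by simp [policyPattern]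

theorem setSign_policyPattern {n : ℕ} (π : 𝒳 → Bool) (x : Fin n → 𝒳) (i : Fin n) :
    setSign (policyPattern π x) i = signTreat π (x i) := by
  simp [setSign, mem_policyPattern, signTreat_eq]

theorem mem_symmDiff_policyPattern {n : ℕ} (π π' : 𝒳 → Bool) (x : Fin n → 𝒳) (i : Fin n) :
    i ∈ symmDiff (policyPattern π x) (policyPattern π' x) ↔ π (x i) ≠ π' (x i) := by
  rw [Finset.mem_symmDiff, mem_policyPattern, mem_policyPattern]
  cases π (x i) <;> cases π' (x i) <;> simp

/-- Repeated features receive the same decision, so a shattered index set maps injectively to a set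
of features, which `P` shatters. -/
theorem vcDim_policyPattern_le {P : Set (𝒳 → Bool)} {D : ℕ} (hD : policyVCDim P ≤ D) {n : ℕ}
    (x : Fin n → 𝒳) (T : Finset (Finset (Fin n)))
    (hT : ∀ A ∈ T, ∃ π ∈ P, policyPattern π x = A) : T.vcDim ≤ D := by
  classical
  refine Finset.sup_le fun s hs => ?_
  rw [Finset.mem_shatterer] at hs
  have hinj : Set.InjOn x s := by
    intro i hi j hj hij
    by_contra hne
    obtain ⟨A, hA, hAs⟩ := hs.exists_inter_eq_singleton hi
    obtain ⟨π, -, rfl⟩ := hT A hA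
    have h1 : i ∈ s ∩ policyPattern π x := by rw [hAs]; simp
    have h2 : j ∈ s ∩ policyPattern π x := by
      rw [Finset.mem_inter, mem_policyPattern] at h1 ⊢
      exact ⟨hj, hij ▸ h1.2⟩
    rw [hAs, Finset.mem_singleton] at h2
    exact hne h2.symm
  have hsh : PolicyShatters P (s.image x) := by
    intro b
    obtain ⟨A, hA, hAs⟩ := hs (Finset.filter_subset (fun i => b (x i) = true) s)
    obtain ⟨π, hπ, rfl⟩ := hT A hA
    refine ⟨π, hπ, fun y hy => ?_⟩
    obtain ⟨i, hi, rfl⟩ := Finset.mem_image.1 hy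
    have := Finset.ext_iff.1 hAs i
    simp only [Finset.mem_inter, hi, true_and, mem_policyPattern, Finset.mem_filter] at this
    exact Bool.eq_iff_iff.2 this
  have h1 : ((s.image x).card : ℕ∞) ≤ policyVCDim P :=
    le_iSup₂ (f := fun (s : Finset 𝒳) (_ : PolicyShatters P s) => (s.card : ℕ∞)) _ hsh
  rw [Finset.card_image_of_injOn hinj] at h1
  exact_mod_cast h1.trans hD

end Pattern

/-! ### Conditional complexity and the expected empirical radius. -/

namespace PolicyModel

variable {𝒳 𝒵 𝒲 : Type*} [MeasurableSpace 𝒳] [MeasurableSpace 𝒵] [MeasurableSpace 𝒲]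
  (M : PolicyModel 𝒳 𝒵 𝒲)

theorem sum_symmDiff_policyPattern {n : ℕ} (π π' : 𝒳 → Bool) (ω : Fin n → Obs 𝒳 𝒵 𝒲) :
    ∑ i ∈ symmDiff (policyPattern π fun i => (ω i).1) (policyPattern π' fun i => (ω i).1),
      M.score (ω i) ^ 2 = ∑ i, M.disagreement π π' (ω i) := by
  rw [← Finset.sum_subset (Finset.subset_univ
    (symmDiff (policyPattern π fun i => (ω i).1) (policyPattern π' fun i => (ω i).1)))]
  · refine Finset.sum_congr rfl fun i hi => ?_
    rw [mem_symmDiff_policyPattern] at hi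
    rw [disagreement, if_neg hi]
  · intro i _ hi
    rw [mem_symmDiff_policyPattern, not_not] at hi
    rw [disagreement, if_pos hi]

/-- The chaining bound for the centered Rademacher complexity, given the sample. -/
theorem centeredRademacher_le {n : ℕ} {P : Set (𝒳 → Bool)} {D : ℕ}
    (hD : policyVCDim P ≤ D) (hD1 : 1 ≤ D) (ω : Fin n → Obs 𝒳 𝒵 𝒲) {Q : Set (𝒳 → Bool)}
    (hQ : Q.Nonempty) {e : ℕ → 𝒳 → Bool} (heP : ∀ k, e k ∈ P) (k₀ : ℕ)
    (hdense : ∀ π ∈ Q, ∃ k, ∀ i, e k (ω i).1 = π (ω i).1) {r : ℝ} (hr : 0 < r)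
    (hball : ∀ k, ∑ i, M.disagreement (e k) (e k₀) (ω i) ≤ r ^ 2) :
    M.centeredRademacher n Q ω ≤
      (n : ℝ)⁻¹ * (40 * r * √(D * (1 + Real.log (1 + (∑ i, M.score (ω i) ^ 2) / r ^ 2)))) := by
  classical
  set x : Fin n → 𝒳 := fun i => (ω i).1 with hx
  set γ : Fin n → ℝ := fun i => M.score (ω i) with hγ
  set T : Finset (Finset (Fin n)) :=
    Finset.univ.filter fun A => ∃ k, policyPattern (e k) x = A with hT
  have hmemT : ∀ k, policyPattern (e k) x ∈ T := fun k => by simp [hT]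
  set A' := sSup (M.advantage '' Q) with hA'
  -- Only finitely many patterns occur, so the supremum over `Q` is dominated by a maximizer chosen
  -- as a function of the signs, the form that chaining accepts.
  have hmax : ∀ ξ : Fin n → ℤˣ, ∃ A ∈ T, ∀ B ∈ T, ∑ i, ((ξ i : ℤ) : ℝ) * (γ i * setSign B i) ≤
      ∑ i, ((ξ i : ℤ) : ℝ) * (γ i * setSign A i) := fun ξ =>
    Finset.exists_max_image T (fun A => ∑ i, ((ξ i : ℤ) : ℝ) * (γ i * setSign A i))
      ⟨_, hmemT k₀⟩
  choose a haT ha using hmax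
  have hle : M.centeredRademacher n Q ω ≤ signMean (fun ξ : Fin n → ℤˣ =>
      (n : ℝ)⁻¹ * (∑ i, ((ξ i : ℤ) : ℝ) * (γ i * setSign (a ξ) i)
        + ∑ i, ((ξ i : ℤ) : ℝ) * (-A'))) := by
    have : M.centeredRademacher n Q ω = signMean (fun ξ : Fin n → ℤˣ =>
        sSup ((fun π => (n : ℝ)⁻¹ * ∑ i, ((ξ i : ℤ) : ℝ) *
          (M.score (ω i) * signTreat π (ω i).1 - A')) '' Q)) := by
      simp [centeredRademacher, signMean, hA']
    rw [this]
    refine signMean_mono fun ξ => csSup_le (hQ.image _) ?_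
    rintro _ ⟨π, hπ, rfl⟩
    obtain ⟨k, hk⟩ := hdense π hπ
    dsimp only
    gcongr
    refine le_trans (le_of_eq ?_) (add_le_add (ha ξ _ (hmemT k)) le_rfl)
    rw [← Finset.sum_add_distrib]
    refine Finset.sum_congr rfl fun i _ => ?_
    rw [setSign_policyPattern, signTreat_eq, signTreat_eq, hx, hk i]
    ring
  refine hle.trans ?_
  rw [signMean_const_mul, signMean_add, signMean_sum_const, add_zero]
  gcongr
  refine signMean_chaining_le T γ (vcDim_policyPattern_le hD x T ?_) hD1 (hmemT k₀) hr ?_ a haT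
  · intro A hA
    obtain ⟨k, hk⟩ := (Finset.mem_filter.1 hA).2
    exact ⟨e k, heP k, hk⟩
  · intro A hA
    obtain ⟨k, rfl⟩ := (Finset.mem_filter.1 hA).2
    rw [hγ, hx, sum_symmDiff_policyPattern]
    exact hball k

/-- Policies enter through their patterns only, of which there are at most e n^D by Sauer-Shelah
with x = 1/n. Squaring the summands produces fourth powers of the score. -/
theorem signMean_disagreement_le {n : ℕ} (hn : 1 ≤ n) {P : Set (𝒳 → Bool)} {D : ℕ}
    (hD : policyVCDim P ≤ D) (ω : Fin n → Obs 𝒳 𝒵 𝒲) {e : ℕ → 𝒳 → Bool} (heP : ∀ k, e k ∈ P)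
    (π₀ : 𝒳 → Bool) {t : ℝ} (ht : 0 < t) (a : (Fin n → ℤˣ) → ℕ) :
    signMean (fun ξ => ∑ i, ((ξ i : ℤ) : ℝ) * M.disagreement (e (a ξ)) π₀ (ω i)) ≤
      (D * Real.log n + 1) / t + t / 2 * ∑ i, M.score (ω i) ^ 4 := by
  classical
  set x : Fin n → 𝒳 := fun i => (ω i).1 with hx
  set T : Finset (Finset (Fin n)) :=
    Finset.univ.filter fun A => ∃ k, policyPattern (e k) x = A with hT
  have hmemT : ∀ k, policyPattern (e k) x ∈ T := fun k => by simp [hT]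
  have hn' : (0 : ℝ) < n := by exact_mod_cast hn
  have hn1 : (1 : ℝ) ≤ n := by exact_mod_cast hn
  have hvc : T.vcDim ≤ D := vcDim_policyPattern_le hD x T fun A hA => by
    obtain ⟨k, hk⟩ := (Finset.mem_filter.1 hA).2
    exact ⟨e k, heP k, hk⟩
  have hcard : (T.card : ℝ) ≤ Real.exp (D * Real.log n + 1) := by
    refine (card_le_exp_of_vcDim_le T Finset.univ hvc (fun A _ B _ h => by simpa using h)
      (x := (n : ℝ)⁻¹) (by positivity) (inv_le_one_of_one_le₀ hn1)).trans (le_of_eq ?_)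
    rw [inv_inv, Real.exp_add, Real.exp_nat_mul, Real.exp_log hn', Finset.card_univ,
      Fintype.card_fin, inv_mul_cancel₀ hn'.ne']
  set v : Finset (Fin n) → Fin n → ℝ := fun A i =>
    if i ∈ symmDiff A (policyPattern π₀ x) then M.score (ω i) ^ 2 else 0 with hv
  have h := signMean_selection_le T v (fun ξ => policyPattern (e (a ξ)) x) (fun ξ => hmemT _) ht
    hcard (S := ∑ i, M.score (ω i) ^ 4) (fun A _ => by
      refine Finset.sum_le_sum fun i _ => ?_
      simp only [hv]
      split_ifs
      · exact le_of_eq (by ring)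
      · rw [zero_pow two_ne_zero]; positivity)
  have e1 : (fun ξ : Fin n → ℤˣ => ∑ i, ((ξ i : ℤ) : ℝ) * M.disagreement (e (a ξ)) π₀ (ω i))
      = fun ξ => ∑ i, ((ξ i : ℤ) : ℝ) * v (policyPattern (e (a ξ)) x) i := by
    funext ξ
    refine Finset.sum_congr rfl fun i _ => ?_
    simp only [hv, mem_symmDiff_policyPattern, disagreement, ne_eq, ite_not, hx]
  rw [e1]
  refine h.trans (le_of_eq ?_)
  ring

variable {M}

instance (n : ℕ) : IsProbabilityMeasure (M.sampleLaw n) := by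
  unfold sampleLaw; infer_instance

theorem integral_sum_sample {n : ℕ} {f : Obs 𝒳 𝒵 𝒲 → ℝ} (hf : Integrable f M.law) :
    Integrable (fun ω : Fin n → Obs 𝒳 𝒵 𝒲 => ∑ i, f (ω i)) (M.sampleLaw n) ∧
      ∫ ω, ∑ i : Fin n, f (ω i) ∂(M.sampleLaw n) = n * ∫ o, f o ∂M.law := by
  have hi : ∀ i : Fin n, Integrable (fun ω : Fin n → Obs 𝒳 𝒵 𝒲 => f (ω i)) (M.sampleLaw n) :=
    fun i => (measurePreserving_eval (fun _ : Fin n => M.law) i).integrable_comp_of_integrable hf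
  refine ⟨integrable_finsetSum _ fun i _ => hi i, ?_⟩
  rw [integral_finsetSum _ fun i _ => hi i]
  have : ∀ i : Fin n, ∫ ω : Fin n → Obs 𝒳 𝒵 𝒲, f (ω i) ∂(M.sampleLaw n) = ∫ o, f o ∂M.law :=
    fun i => integral_comp_measurePreserving (measurePreserving_eval (fun _ : Fin n => M.law) i)
      hf.aestronglyMeasurable
  simp [this]

/-- The expected radius of a localized class: symmetrization costs `√(n (D log n + 1))`. -/
theorem lintegral_iSup_disagreement_le (h4 : Integrable (fun o => M.score o ^ 4) M.law) {K : ℝ}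
    (hK : ∫ o, M.score o ^ 4 ∂M.law ≤ K) {n : ℕ} (hn : 1 ≤ n) {P : Set (𝒳 → Bool)}
    (hP : ∀ π ∈ P, Measurable π) {D : ℕ} (hD : policyVCDim P ≤ D)
    {e : ℕ → 𝒳 → Bool} (heP : ∀ k, e k ∈ P) {π₀ : 𝒳 → Bool} (hπ₀ : Measurable π₀) {b : ℝ}
    (hb : ∀ k, ∫ o, M.disagreement (e k) π₀ o ∂M.law ≤ b) :
    ∫⁻ ω, ⨆ k, ENNReal.ofReal (∑ i, M.disagreement (e k) π₀ (ω i)) ∂(M.sampleLaw n) ≤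
      ENNReal.ofReal (n * b + (2 + K) * √(n * (D * Real.log n + 1))) := by
  set Y : ℕ → (Fin n → Obs 𝒳 𝒵 𝒲) → ℝ := fun k ω => ∑ i, M.disagreement (e k) π₀ (ω i) with hY
  have hid := fun k => integrable_disagreement h4 (hP _ (heP k)) hπ₀
  have hn' : (0 : ℝ) < n := by exact_mod_cast hn
  set ℓ : ℝ := D * Real.log n + 1 with hℓ
  have hℓ0 : 0 < ℓ := by
    have := Real.log_natCast_nonneg n
    positivity
  have hYm : ∀ k, Measurable (Y k) := fun k => Finset.measurable_fun_sum _ fun i _ =>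
    (measurable_disagreement (hP _ (heP k)) hπ₀).comp (measurable_pi_apply i)
  have hY0 : ∀ k ω, 0 ≤ Y k ω := fun k ω =>
    Finset.sum_nonneg fun i _ => M.disagreement_nonneg _ _ _
  have hFn : ∀ N : ℕ, (Finset.range (N + 1)).Nonempty := fun N => by simp
  have hbound : ∀ N : ℕ, ∫ ω, (Finset.range (N + 1)).sup' (hFn N) (fun k => Y k ω) ∂(M.sampleLaw n)
      ≤ n * b + (2 + K) * √(n * ℓ) := by
    intro N
    -- The choice t = √(ℓ/n) makes both ℓ/t and t n equal to √(nℓ).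
    have h := integral_sup'_sub_le M.law n (hFn N) hid h4 (ℓ / √(ℓ / n)) (√(ℓ / n) / 2)
      (fun ω a _ => M.signMean_disagreement_le hn hD ω heP π₀ (by positivity) a)
    have hint : Integrable (fun ω : Fin n → Obs 𝒳 𝒵 𝒲 => (Finset.range (N + 1)).sup' (hFn N)
        (fun k => Y k ω - n * ∫ o, M.disagreement (e k) π₀ o ∂M.law)) (M.sampleLaw n) :=
      integrable_finset_sup' (hFn N) fun k _ =>
        (integral_sum_sample (hid k)).1.sub (integrable_const _)
    have h1 : ∫ ω, (Finset.range (N + 1)).sup' (hFn N) (fun k => Y k ω) ∂(M.sampleLaw n) ≤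
        ∫ ω, ((Finset.range (N + 1)).sup' (hFn N)
          (fun k => Y k ω - n * ∫ o, M.disagreement (e k) π₀ o ∂M.law) + n * b)
          ∂(M.sampleLaw n) := by
      refine integral_mono (integrable_finset_sup' (hFn N) fun k _ =>
        (integral_sum_sample (hid k)).1) (hint.add (integrable_const _)) fun ω => ?_
      refine Finset.sup'_le _ _ fun k hk => ?_
      have h2 := Finset.le_sup'
        (fun k => Y k ω - n * ∫ o, M.disagreement (e k) π₀ o ∂M.law) hk
      have h3 : n * ∫ o, M.disagreement (e k) π₀ o ∂M.law ≤ n * b := by gcongr; exact hb k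
      dsimp only at h2 ⊢
      linarith
    rw [integral_add hint (integrable_const _)] at h1
    simp only [integral_const, probReal_univ, one_smul] at h1
    have h5 : ∫ ω, (Finset.range (N + 1)).sup' (hFn N)
        (fun k => Y k ω - n * ∫ o, M.disagreement (e k) π₀ o ∂M.law) ∂(M.sampleLaw n)
        ≤ 2 * (ℓ / √(ℓ / n) + √(ℓ / n) / 2 * (n * K)) := by
      refine h.trans ?_
      gcongr
    have h6 : ℓ / √(ℓ / n) = √(n * ℓ) := by
      rw [div_eq_iff (by positivity), ← Real.sqrt_mul (by positivity),
        show n * ℓ * (ℓ / n) = ℓ ^ 2 by field_simp, Real.sqrt_sq hℓ0.le]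
    have h7 : √(ℓ / n) * n = √(n * ℓ) := by
      nth_rw 2 [← Real.sqrt_sq hn'.le]
      rw [← Real.sqrt_mul (by positivity)]
      congr 1
      field_simp
    have h8 : 2 * (ℓ / √(ℓ / n) + √(ℓ / n) / 2 * (n * K)) = (2 + K) * √(n * ℓ) := by
      rw [h6]
      calc _ = 2 * √(n * ℓ) + (√(ℓ / n) * n) * K := by ring
        _ = _ := by rw [h7]; ring
    linarith
  have hmono : Monotone fun (N : ℕ) (ω : Fin n → Obs 𝒳 𝒵 𝒲) =>
      ENNReal.ofReal ((Finset.range (N + 1)).sup' (hFn N) fun k => Y k ω) := by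
    intro N N' h ω
    exact ENNReal.ofReal_le_ofReal (Finset.sup'_mono _
      (Finset.range_mono (by omega)) (hFn N))
  have hmeas : ∀ N : ℕ, Measurable fun ω : Fin n → Obs 𝒳 𝒵 𝒲 =>
      ENNReal.ofReal ((Finset.range (N + 1)).sup' (hFn N) fun k => Y k ω) := fun N => by
    have := Finset.measurable_range_sup'' (f := Y) (n := N) fun k _ => hYm k
    exact this.ennreal_ofReal
  calc ∫⁻ ω, ⨆ k, ENNReal.ofReal (Y k ω) ∂(M.sampleLaw n)
      ≤ ∫⁻ ω, ⨆ N : ℕ, ENNReal.ofReal ((Finset.range (N + 1)).sup' (hFn N) fun k => Y k ω)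
          ∂(M.sampleLaw n) := by
        refine lintegral_mono fun ω => iSup_mono fun k => ENNReal.ofReal_le_ofReal ?_
        exact Finset.le_sup' (fun k => Y k ω) (Finset.mem_range.2 (Nat.lt_succ_self k))
    _ = ⨆ N : ℕ, ∫⁻ ω, ENNReal.ofReal ((Finset.range (N + 1)).sup' (hFn N) fun k => Y k ω)
          ∂(M.sampleLaw n) := lintegral_iSup hmeas hmono
    _ ≤ _ := by
        refine iSup_le fun N => ?_
        rw [← ofReal_integral_eq_lintegral_ofReal (integrable_finset_sup' (hFn N) fun k _ =>
          (integral_sum_sample (hid k)).1) (Eventually.of_forall fun ω => ?_)]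
        · exact ENNReal.ofReal_le_ofReal (hbound N)
        · exact (hY0 0 ω).trans (Finset.le_sup' (fun k => Y k ω) (by simp))

end PolicyModel

/-! ### The finite-sample bound and its comparison with the rate. -/

theorem outerExpectation_le_lintegral {Ω : Type*} [MeasurableSpace Ω] (μ : Measure Ω)
    {f h : Ω → ℝ≥0∞} (hh : Measurable h) (hfh : ∀ ω, f ω ≤ h ω) :
    outerExpectation μ f ≤ ∫⁻ ω, h ω ∂μ :=
  iInf_le_of_le h (iInf_le_of_le hh (iInf_le_of_le hfh le_rfl))

namespace PolicyModel

variable {𝒳 𝒵 𝒲 : Type*} [MeasurableSpace 𝒳] [MeasurableSpace 𝒵] [MeasurableSpace 𝒲]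
  {M : PolicyModel 𝒳 𝒵 𝒲}

/-- The arithmetic-geometric mean inequality makes the bound affine in r² and g, so that first
moments of both suffice. -/
theorem mul_sqrt_le_of_pos {r D g θ : ℝ} (hD : 0 ≤ D) (hg : 0 ≤ g) (hθ : 0 < θ) :
    2 * (r * √(D * g)) ≤ √D * (θ * r ^ 2 + g / θ) := by
  rw [Real.sqrt_mul hD]
  have h1 : √g ^ 2 = g := Real.sq_sqrt hg
  have h2 : 2 * (r * √g) ≤ θ * r ^ 2 + g / θ := by
    rw [← sub_nonneg]
    have : θ * r ^ 2 + g / θ - 2 * (r * √g) = (θ * r - √g) ^ 2 / θ := by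
      rw [sub_sq, h1]; field_simp; ring
    rw [this]
    positivity
  calc 2 * (r * (√D * √g)) = √D * (2 * (r * √g)) := by ring
    _ ≤ _ := by gcongr

theorem log_one_add_le_tangent {y y₀ : ℝ} (hy : 0 ≤ y) (hy₀ : 0 ≤ y₀) :
    Real.log (1 + y) ≤ Real.log (1 + y₀) + (y - y₀) / (1 + y₀) := by
  have h := Real.log_le_sub_one_of_pos (x := (1 + y) / (1 + y₀)) (by positivity)
  rw [Real.log_div (by positivity) (by positivity)] at h
  have : (1 + y) / (1 + y₀) - 1 = (y - y₀) / (1 + y₀) := by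
    field_simp; ring
  linarith

/-- The finite-sample bound for the expected centered Rademacher complexity of a slice. -/
theorem outerExpectation_centeredRademacher_le
    (h4 : Integrable (fun o => M.score o ^ 4) M.law) {K : ℝ}
    (hK : ∫ o, M.score o ^ 4 ∂M.law ≤ K) (hid : M.ScoreIdentifies) {n : ℕ} (hn : 1 ≤ n)
    {P : Set (𝒳 → Bool)} (hP : PointwiseMeasurableClass P) {D : ℕ} (hD : policyVCDim P ≤ D)
    (hD1 : 1 ≤ D) {lam σ2 : ℝ} (hσ2 : σ2 = M.sliceVariance n P lam + 4 * lam ^ 2) (hσ : 0 < σ2)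
    (hne : (M.slice P lam).Nonempty) (herr : (2 + K) * √(n * (D * Real.log n + 1)) ≤ n * σ2) :
    outerExpectation (M.sampleLaw n)
        (fun ω => ENNReal.ofReal (M.centeredRademacher n (M.slice P lam) ω)) ≤
      ENNReal.ofReal
        (100 * √(D * σ2 * (1 + Real.log (1 + M.scoreSecondMoment / σ2)) / n)) := by
  obtain ⟨π₀, hπ₀⟩ := hne
  obtain ⟨e, heP, hediff, ⟨k₀, hk₀⟩, hdense⟩ :=
    exists_dense_sequence h4 hid hn hP (hσ2 ▸ hσ) hπ₀
  rw [← hσ2] at hediff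
  have hn' : (0 : ℝ) < n := by exact_mod_cast hn
  have hnσ : 0 < n * σ2 := by positivity
  have hD0 : (0 : ℝ) < D := by exact_mod_cast hD1
  set S := M.scoreSecondMoment with hS
  have hS0 : 0 ≤ S := integral_nonneg fun o => sq_nonneg _
  set y₀ := S / σ2 with hy₀
  have hy₀0 : 0 ≤ y₀ := by positivity
  set q := 1 + Real.log (1 + y₀) with hq
  have hq1 : 1 ≤ q := by
    have := Real.log_nonneg (by linarith : 1 ≤ 1 + y₀)
    linarith
  -- This value minimizes θ r² + q/θ at the typical radius r² = nσ².
  set θ := √(q / (n * σ2)) with hθ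
  have hθ0 : 0 < θ := by positivity
  set c := (n : ℝ)⁻¹ * 20 * √D with hc
  have hc0 : 0 < c := by positivity
  set W : (Fin n → Obs 𝒳 𝒵 𝒲) → ℝ := fun ω => ∑ i, M.score (ω i) ^ 2 with hW
  have hW0 : ∀ ω, 0 ≤ W ω := fun ω => Finset.sum_nonneg fun i _ => sq_nonneg _
  set U : (Fin n → Obs 𝒳 𝒵 𝒲) → ℝ≥0∞ := fun ω =>
    ⨆ k, ENNReal.ofReal (∑ i, M.disagreement (e k) π₀ (ω i)) with hU
  have hUm : Measurable U := Measurable.iSup fun k => Measurable.ennreal_ofReal <|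
    Finset.measurable_fun_sum _ fun i _ =>
      (measurable_disagreement (hP.1 _ (heP k)) (hP.1 _ hπ₀.1)).comp (measurable_pi_apply i)
  have hUtop : ∀ ω, U ω ≠ ∞ := fun ω => ne_top_of_le_ne_top (ENNReal.ofReal_ne_top (r := W ω))
    (iSup_le fun k => ENNReal.ofReal_le_ofReal
      (Finset.sum_le_sum fun i _ => M.disagreement_le _ _ _))
  set c₂ := c * (θ * (n * σ2) + (q - y₀ / (1 + y₀)) / θ) with hc₂
  set c₃ := c / (n * σ2 * (1 + y₀) * θ) with hc₃
  have hc₂0 : 0 ≤ c₂ := by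
    have h1 : y₀ / (1 + y₀) ≤ 1 := by rw [div_le_one (by positivity)]; linarith
    have h2 : 0 ≤ q - y₀ / (1 + y₀) := by linarith
    positivity
  have hc₃0 : 0 ≤ c₃ := by positivity
  have hpt : ∀ ω, M.centeredRademacher n (M.slice P lam) ω ≤
      c * θ * (U ω).toReal + (c₂ + c₃ * W ω) := by
    intro ω
    set u := (U ω).toReal with hu
    have hu0 : 0 ≤ u := ENNReal.toReal_nonneg
    -- Adding nσ² to the empirical radius keeps it positive and bounds the logarithm by one that
    -- involves only `W`. The tangent point `y₀` used next is the mean of W/(nσ²), so the linear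
    -- correction integrates to zero.
    have hr2 : √(n * σ2 + u) ^ 2 = n * σ2 + u := Real.sq_sqrt (by positivity)
    have h1 := M.centeredRademacher_le hD hD1 ω ⟨π₀, hπ₀⟩ heP k₀
      (fun π hπ => hdense π hπ fun i => (ω i).1) (r := √(n * σ2 + u)) (by positivity) (fun k => by
        rw [hr2, hk₀]
        have : ∑ i, M.disagreement (e k) π₀ (ω i) ≤ u := by
          rw [hu, ← ENNReal.ofReal_le_iff_le_toReal (hUtop ω)]
          exact le_iSup (fun k => ENNReal.ofReal (∑ i, M.disagreement (e k) π₀ (ω i))) k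
        linarith)
    have h2 : 1 + Real.log (1 + (∑ i, M.score (ω i) ^ 2) / √(n * σ2 + u) ^ 2)
        ≤ q + (W ω / (n * σ2) - y₀) / (1 + y₀) := by
      have h3 := log_one_add_le_tangent (y := W ω / (n * σ2)) (y₀ := y₀)
        (div_nonneg (hW0 ω) hnσ.le) hy₀0
      have h4 : Real.log (1 + (∑ i, M.score (ω i) ^ 2) / √(n * σ2 + u) ^ 2)
          ≤ Real.log (1 + W ω / (n * σ2)) := by
        have := hW0 ω
        rw [hr2]
        refine Real.log_le_log (by positivity) ?_
        gcongr
        linarith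
      linarith
    have hg0 : 0 ≤ q + (W ω / (n * σ2) - y₀) / (1 + y₀) := by
      refine le_trans ?_ h2
      have := hW0 ω
      have : 0 ≤ Real.log (1 + (∑ i, M.score (ω i) ^ 2) / √(n * σ2 + u) ^ 2) :=
        Real.log_nonneg (by
          have : 0 ≤ (∑ i, M.score (ω i) ^ 2) / √(n * σ2 + u) ^ 2 := by positivity
          linarith)
      linarith
    have h5 := mul_sqrt_le_of_pos (r := √(n * σ2 + u)) hD0.le hg0 hθ0
    calc M.centeredRademacher n (M.slice P lam) ω
        ≤ (n : ℝ)⁻¹ * (40 * √(n * σ2 + u)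
          * √(D * (q + (W ω / (n * σ2) - y₀) / (1 + y₀)))) := by
          refine h1.trans ?_
          gcongr
      _ = (n : ℝ)⁻¹ * 20 * (2 * (√(n * σ2 + u)
          * √(D * (q + (W ω / (n * σ2) - y₀) / (1 + y₀))))) := by ring
      _ ≤ (n : ℝ)⁻¹ * 20 * (√D * (θ * √(n * σ2 + u) ^ 2
          + (q + (W ω / (n * σ2) - y₀) / (1 + y₀)) / θ)) := by gcongr
      _ = _ := by
          rw [hr2, hc₂, hc₃, hc]
          field_simp
          ring
  have hWi := integral_sum_sample (n := n) (integrable_score_sq h4)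
  have hmaj : Measurable fun ω => ENNReal.ofReal (c * θ) * U ω
      + ENNReal.ofReal (c₂ + c₃ * W ω) := by
    refine (hUm.const_mul _).add (Measurable.ennreal_ofReal (Measurable.const_add
      (Measurable.const_mul ?_ _) _))
    exact Finset.measurable_fun_sum _ fun i _ =>
      (M.measurable_score.pow_const 2).comp (measurable_pi_apply i)
  refine (outerExpectation_le_lintegral _ hmaj fun ω => ?_).trans ?_
  · refine (ENNReal.ofReal_le_ofReal (hpt ω)).trans (ENNReal.ofReal_add_le.trans ?_)
    rw [ENNReal.ofReal_mul (by positivity), ENNReal.ofReal_toReal (hUtop ω)]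
  rw [lintegral_add_left (hUm.const_mul _), lintegral_const_mul _ hUm]
  have hI1 := lintegral_iSup_disagreement_le h4 hK hn hP.1 hD heP (hP.1 _ hπ₀.1) hediff
  have hI2 : ∫⁻ ω, ENNReal.ofReal (c₂ + c₃ * W ω) ∂(M.sampleLaw n)
      = ENNReal.ofReal (c₂ + c₃ * (n * S)) := by
    have hi : Integrable (fun ω => c₃ * W ω) (M.sampleLaw n) := hWi.1.const_mul c₃
    have hi' : Integrable (fun ω => c₂ + c₃ * W ω) (M.sampleLaw n) := (integrable_const c₂).add hi
    rw [← ofReal_integral_eq_lintegral_ofReal hi' (Eventually.of_forall fun ω =>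
      add_nonneg hc₂0 (mul_nonneg hc₃0 (hW0 ω)))]
    congr 1
    rw [integral_add (integrable_const c₂) hi, integral_const_mul c₃, hWi.2]
    simp [hS, scoreSecondMoment]
  -- The radius contributes 2nσ² from the ball, nσ² from the symmetrization error and nσ² from the
  -- offset. With q/θ this makes five equal terms, and 5 · 20 = 100.
  have hfinal : c * θ * (n * (2 * σ2) + n * σ2) + (c₂ + c₃ * (n * S))
      = 100 * √(D * σ2 * q / n) := by
    have e1 : θ * (n * σ2) = √(q * (n * σ2)) := by
      rw [hθ]
      nth_rw 2 [← Real.sqrt_sq hnσ.le]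
      rw [← Real.sqrt_mul (by positivity)]
      congr 1
      field_simp
    have e2 : q / θ = √(q * (n * σ2)) := by
      rw [div_eq_iff hθ0.ne', hθ, ← Real.sqrt_mul (by positivity),
        show q * (n * σ2) * (q / (n * σ2)) = q ^ 2 by field_simp, Real.sqrt_sq (by linarith)]
    have e3 : c₃ * (n * S) = c * (y₀ / (1 + y₀) / θ) := by
      rw [hc₃, show S = y₀ * σ2 by rw [hy₀]; field_simp]
      field_simp
    have e4 : √(D * σ2 * q / n) = (n : ℝ)⁻¹ * √D * √(q * (n * σ2)) := by
      rw [show D * σ2 * q / n = ((n : ℝ)⁻¹) ^ 2 * (D * (q * (n * σ2))) by field_simp,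
        Real.sqrt_mul (by positivity), Real.sqrt_sq (by positivity), Real.sqrt_mul hD0.le,
        mul_assoc]
    rw [e3, hc₂, e4]
    calc _ = c * (4 * (θ * (n * σ2)) + q / θ) := by ring
      _ = _ := by rw [e1, e2, hc]; ring
  calc _ ≤ ENNReal.ofReal (c * θ) * ENNReal.ofReal (n * (2 * σ2) + n * σ2)
        + ENNReal.ofReal (c₂ + c₃ * (n * S)) := by
        rw [hI2]
        gcongr
        exact hI1.trans (ENNReal.ofReal_le_ofReal (by linarith))
    _ = _ := by
        rw [← ENNReal.ofReal_mul (by positivity), ← ENNReal.ofReal_add (by positivity)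
          (by positivity), hfinal]

theorem slice_nonempty_of_pos {P : Set (𝒳 → Bool)} (hP : P.Nonempty) {lam : ℝ} (hlam : 0 < lam) :
    (M.slice P lam).Nonempty := by
  obtain ⟨_, ⟨π, hπ, rfl⟩, h⟩ := exists_lt_of_lt_csSup (hP.image M.value)
    (sub_lt_self (sSup (M.value '' P)) hlam)
  exact ⟨π, hπ, by unfold regret; linarith⟩

/-- An empty slice has variance 0 because `sSup ∅ = 0`. This serves the case `lam = 0`, where an
optimal policy may fail to exist. -/
theorem slice_nonempty_of_sliceVariance_pos {n : ℕ} {P : Set (𝒳 → Bool)} {lam : ℝ}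
    (h : 0 < M.sliceVariance n P lam) : (M.slice P lam).Nonempty := by
  by_contra hne
  rw [Set.not_nonempty_iff_eq_empty] at hne
  simp [sliceVariance, hne] at h

/-- For u = S/V ≥ 1, log(1 + u) ≤ log 2 + log u; rounding the base-4 logarithm costs at most log 4,
and 1 + 3 log 2 < 4. -/
theorem one_add_log_le {S V : ℝ} (hV : 0 < V) (hVS : V ≤ S) :
    1 + Real.log (1 + S / V) ≤ 4 * (1 + (⌊Real.logb 4 (S / V)⌋ : ℝ)) := by
  have h1 : 1 ≤ S / V := by rwa [one_le_div hV]
  have h2 : 0 ≤ Real.logb 4 (S / V) := Real.logb_nonneg (by norm_num) h1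
  have h3 := Int.lt_floor_add_one (Real.logb 4 (S / V))
  have h4 : (0 : ℝ) ≤ ⌊Real.logb 4 (S / V)⌋ := by exact_mod_cast Int.floor_nonneg.2 h2
  have h5 : Real.log (1 + S / V) ≤ Real.log 2 + Real.log (S / V) := by
    rw [← Real.log_mul (by norm_num) (by positivity)]
    exact Real.log_le_log (by positivity) (by linarith)
  have hl4 : Real.log 4 = 2 * Real.log 2 := by
    rw [show (4 : ℝ) = 2 ^ 2 by norm_num, Real.log_pow]; norm_num
  have h6 : Real.log (S / V) = Real.logb 4 (S / V) * Real.log 4 := by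
    rw [Real.logb, div_mul_cancel₀]
    rw [hl4]
    have : 0 < Real.log 2 := Real.log_pos (by norm_num)
    positivity
  have := Real.log_two_lt_d9
  have : 0 < Real.log 2 := Real.log_pos (by norm_num)
  rw [hl4] at h6
  nlinarith

theorem ofReal_sqrt_le_sliceRate (h4 : Integrable (fun o => M.score o ^ 4) M.law) {n : ℕ}
    (hn : 1 ≤ n) {P : Set (𝒳 → Bool)} (hP : ∀ π ∈ P, Measurable π) {D : ℕ} {d : ℝ}
    (hd : 0 < d) (hDd : (D : ℝ) ≤ d) {lam σ2 : ℝ}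
    (hσ2 : σ2 = M.sliceVariance n P lam + 4 * lam ^ 2) (hσ : 0 < σ2) :
    ENNReal.ofReal
        (100 * √(D * σ2 * (1 + Real.log (1 + M.scoreSecondMoment / σ2)) / n)) ≤
      ENNReal.ofReal 200 * M.sliceRate n P d lam := by
  have hn' : (0 : ℝ) < n := by exact_mod_cast hn
  have hV0 := M.sliceVariance_nonneg n P lam
  have hdn : 0 < d / n := by positivity
  rw [sliceRate, ← hσ2]
  -- If the slice variance vanishes the rate is infinite; otherwise S/σ² ≤ S/V and the constant 4
  -- leaves the square root as a factor 2.
  rcases hV0.eq_or_lt with hV | hV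
  · rw [logFactor, if_pos hV.symm, ENNReal.mul_top (ENNReal.ofReal_pos.2 hσ).ne',
      ENNReal.top_mul (ENNReal.ofReal_pos.2 hdn).ne', ENNReal.top_rpow_of_pos (by norm_num),
      ENNReal.mul_top (by norm_num)]
    exact le_top
  · have hVS := sliceVariance_le h4 hn hP lam
    set V := M.sliceVariance n P lam
    set S := M.scoreSecondMoment
    have h1 := one_add_log_le hV hVS
    set L : ℝ := 1 + (⌊Real.logb 4 (S / V)⌋ : ℝ) with hL
    have hS0 : 0 ≤ S := hV0.trans hVS
    have hVσ : V ≤ σ2 := by rw [hσ2]; nlinarith [sq_nonneg lam]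
    have h2 : 1 + Real.log (1 + S / σ2) ≤ 4 * L := by
      refine le_trans ?_ h1
      gcongr
    have hq0 : 0 ≤ 1 + Real.log (1 + S / σ2) := by
      have : 0 ≤ S / σ2 := by positivity
      have := Real.log_nonneg (by linarith : 1 ≤ 1 + S / σ2)
      linarith
    have hL0 : 0 ≤ L := by linarith
    rw [logFactor, if_neg hV.ne', ← hL, ← ENNReal.ofReal_mul hσ.le,
      ← ENNReal.ofReal_mul (by positivity),
      ENNReal.ofReal_rpow_of_nonneg (by positivity) (by norm_num), ← Real.sqrt_eq_rpow,
      ← ENNReal.ofReal_mul (by norm_num)]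
    refine ENNReal.ofReal_le_ofReal ?_
    have h3 : √(D * σ2 * (1 + Real.log (1 + S / σ2)) / n) ≤ 2 * √(σ2 * L * (d / n)) := by
      rw [show (2 : ℝ) = √4 by
        rw [show (4 : ℝ) = 2 ^ 2 by norm_num, Real.sqrt_sq (by norm_num)],
        ← Real.sqrt_mul (by norm_num)]
      refine Real.sqrt_le_sqrt ?_
      calc D * σ2 * (1 + Real.log (1 + S / σ2)) / n ≤ d * σ2 * (4 * L) / n := by gcongr
        _ = _ := by ring
    linarith

end PolicyModel

/-! ### Large sample sizes and the conclusion. -/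

theorem eventually_rpow_mul_log_le {β : ℝ} (hβ : β < 1) {ε : ℝ} (hε : 0 < ε) :
    ∀ᶠ n : ℕ in atTop, (n : ℝ) ^ β * Real.log n + 1 ≤ ε * n := by
  have h1 : Tendsto (fun x : ℝ => Real.log x / x ^ (1 - β)) atTop (nhds 0) :=
    (isLittleO_log_rpow_atTop (by linarith)).tendsto_div_nhds_zero
  have h2 : Tendsto (fun n : ℕ => Real.log (n : ℝ) / (n : ℝ) ^ (1 - β)) atTop (nhds 0) :=
    h1.comp tendsto_natCast_atTop_atTop
  have h3 : ∀ᶠ n : ℕ in atTop, 2 / ε ≤ (n : ℝ) :=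
    tendsto_natCast_atTop_atTop.eventually_ge_atTop _
  filter_upwards [h2.eventually (gt_mem_nhds (half_pos hε)), h3, eventually_ge_atTop 1]
    with n hn1 hn2 hn3
  have hn' : (0 : ℝ) < n := by exact_mod_cast hn3
  rw [div_lt_iff₀ (Real.rpow_pos_of_pos hn' _)] at hn1
  have h4 : (n : ℝ) ^ β * (n : ℝ) ^ (1 - β) = n := by
    rw [← Real.rpow_add hn']; simp
  have h5 : (n : ℝ) ^ β * Real.log n ≤ ε / 2 * n := by
    calc (n : ℝ) ^ β * Real.log n ≤ (n : ℝ) ^ β * (ε / 2 * (n : ℝ) ^ (1 - β)) := by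
          have := Real.rpow_pos_of_pos hn' β
          gcongr
      _ = ε / 2 * ((n : ℝ) ^ β * (n : ℝ) ^ (1 - β)) := by ring
      _ = _ := by rw [h4]
  rw [div_le_iff₀ hε] at hn2
  linarith

theorem exists_nat_vcDim_le {v : ℕ∞} {d : ℝ} (hd : 1 ≤ d)
    (h : (v : ℝ≥0∞) ≤ ENNReal.ofReal d) : ∃ D : ℕ, v ≤ D ∧ 1 ≤ D ∧ (D : ℝ) ≤ d := by
  have hv : v ≠ ⊤ := by
    rintro rfl
    simp at h
  lift v to ℕ using hv
  -- The maximum with 1 covers dimension 0, since chaining needs D ≥ 1.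
  refine ⟨max v 1, by exact_mod_cast le_max_left _ _, le_max_right _ _, ?_⟩
  rw [Nat.cast_max]
  refine max_le ?_ (by simpa using hd)
  rw [ENat.toENNReal_coe, ← ENNReal.ofReal_natCast, ENNReal.ofReal_le_ofReal_iff (by linarith)] at h
  exact h

theorem lemma1 :
    ∃ C : ℝ, 0 < C ∧
      ∀ (𝒳 𝒵 𝒲 : Type*) [MeasurableSpace 𝒳] [MeasurableSpace 𝒵] [MeasurableSpace 𝒲]
        (M : ℕ → PolicyModel 𝒳 𝒵 𝒲) (P : ℕ → Set (𝒳 → Bool)),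
        (∀ n, 1 ≤ n → (M n).ScoreIdentifies) →
        (∀ n, 1 ≤ n → (P n).Nonempty ∧ PointwiseMeasurableClass (P n)) →
        ∀ (β : ℝ) (d : ℕ → ℝ), 0 < β → β < 1 / 2 →
        (∀ n : ℕ, 1 ≤ n → 1 ≤ d n ∧ d n ≤ (n : ℝ) ^ β ∧
          ((policyVCDim (P n) : ℕ∞) : ℝ≥0∞) ≤ ENNReal.ofReal (d n)) →
        ∀ (Cν ν s : ℝ), 0 < Cν → 0 < ν → 0 < s →
        (∀ n, 1 ≤ n → ∀ t : ℝ, 0 < t →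
          (M n).law.real {o | t < |(M n).score o|} ≤ Cν * Real.exp (-ν * t ^ 2)) →
        (∀ n, 1 ≤ n → s ^ 2 ≤ ProbabilityTheory.variance (M n).score (M n).law) →
        ∀ lam : ℝ, 0 ≤ lam →
        (lam = 0 → ∃ c : ℝ, 0 < c ∧ ∀ᶠ n in atTop, c ≤ (M n).sliceVariance n (P n) lam) →
        limsup (fun n : ℕ =>
          outerExpectation ((M n).sampleLaw n)
              (fun ω => ENNReal.ofReal
                ((M n).centeredRademacher n ((M n).slice (P n) lam) ω)) /
            (M n).sliceRate n (P n) (d n) lam) atTop ≤ ENNReal.ofReal C := by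
  refine ⟨200, by norm_num, ?_⟩
  intro 𝒳 𝒵 𝒲 _ _ _ M P hid hP β d hβ0 hβ hd Cν ν s hCν hν _ htail _ lam hlam hlam0
  obtain ⟨K, hK0, hK⟩ := exists_integral_pow_four_le Cν ν hCν hν
  -- A lower bound for σ² that does not depend on `n`: it is 4λ² for positive λ, and the assumed
  -- bound on the slice variance for λ = 0.
  obtain ⟨κ, hκ0, hκ⟩ : ∃ κ : ℝ, 0 < κ ∧ ∀ᶠ n in atTop,
      κ ≤ (M n).sliceVariance n (P n) lam + 4 * lam ^ 2 ∧
        ((P n).Nonempty → ((M n).slice (P n) lam).Nonempty) := by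
    rcases hlam.eq_or_lt with h | h
    · obtain ⟨c, hc0, hc⟩ := hlam0 h.symm
      refine ⟨c, hc0, hc.mono fun n hn => ⟨by nlinarith [sq_nonneg lam], fun _ =>
        PolicyModel.slice_nonempty_of_sliceVariance_pos (hc0.trans_le hn)⟩⟩
    · exact ⟨4 * lam ^ 2, by positivity, Eventually.of_forall fun n =>
        ⟨by linarith [(M n).sliceVariance_nonneg n (P n) lam],
          fun hne => PolicyModel.slice_nonempty_of_pos hne h⟩⟩
  -- With this ε the symmetrization error (2 + K) √(n · εn) equals nκ, hence is at most nσ².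
  have hrate := eventually_rpow_mul_log_le (β := β) (by linarith)
    (ε := (κ / (2 + K)) ^ 2) (by positivity)
  refine limsup_le_of_le (by isBoundedDefault) ?_
  filter_upwards [hκ, hrate, eventually_ge_atTop 1] with n ⟨hκn, hne⟩ hrn hn
  obtain ⟨hd1, hdn, hvc⟩ := hd n hn
  obtain ⟨D, hD, hD1, hDd⟩ := exists_nat_vcDim_le hd1 hvc
  obtain ⟨h4, hK4⟩ := hK (M n).law (M n).score (M n).measurable_score (htail n hn)
  have hσ : 0 < (M n).sliceVariance n (P n) lam + 4 * lam ^ 2 := hκ0.trans_le hκn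
  refine ENNReal.div_le_of_le_mul ?_
  refine (PolicyModel.outerExpectation_centeredRademacher_le h4 hK4 (hid n hn) hn (hP n hn).2 hD hD1
    rfl hσ (hne (hP n hn).1) ?_).trans
    (PolicyModel.ofReal_sqrt_le_sliceRate h4 hn (hP n hn).2.1 (by linarith) hDd rfl hσ)
  have hn' : (0 : ℝ) < n := by exact_mod_cast hn
  have h5 : D * Real.log n + 1 ≤ (κ / (2 + K)) ^ 2 * n := by
    refine le_trans ?_ hrn
    have := Real.log_natCast_nonneg n
    gcongr
    exact hDd.trans hdn
  have h6 : √(n * (D * Real.log n + 1)) ≤ n * (κ / (2 + K)) := by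
    refine Real.sqrt_le_iff.2 ⟨by positivity, ?_⟩
    calc n * (D * Real.log n + 1) ≤ n * ((κ / (2 + K)) ^ 2 * n) := by gcongr
      _ = _ := by ring
  calc (2 + K) * √(n * (D * Real.log n + 1)) ≤ (2 + K) * (n * (κ / (2 + K))) := by gcongr
    _ = n * κ := by field_simp
    _ ≤ _ := by gcongr
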